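/- Let $d\ge 2$. For an integer $L\ge 1$ let $\Lambda_L$ be the $d$-dimensional discrete torus of side length $L$, i.e. $[-L/2,L/2)^d\cap\mathbb Z^d$ with nearest-neighbour edges and periodic boundary conditions, each edge being present in both orientations; let $o$ be its origin. A self-avoiding polygon is a finite connected directed graph, contained in $\Lambda_L$ (or in $\mathbb Z^d$), in which every vertex has exactly one ingoing and one outgoing edge; the empty polygon is allowed. Let $\|\gamma\|$ be the number of edges of a polygon $\gamma$. For $x\in\Lambda_L$ let $\mathrm{SAP}_x$ be the set of all polygons in $\Lambda_L$ that contain $x$, together with the empty polygon. For $\alpha,\lambda\in\mathbb R$, the model of interacting self-avoiding polygons is the probability measure on $\Omega=\prod_{x\in\Lambda_L}\mathrm{SAP}_x$ given by $$\mathbb P_{L,\alpha,\lambda}(\boldsymbol\gamma)=\frac{1}{Z(L,\alpha,\lambda)}\,e^{-\mathcal H_{L,\alpha,\lambda}(\boldsymbol\gamma)},\qquad Z(L,\alpha,\lambda)=\sum_{\boldsymbol\gamma\in\Omega}e^{-\mathcal H_{L,\alpha,\lambda}(\boldsymbol\gamma)},$$ $$\mathcal H_{L,\alpha,\lambda}(\boldsymbol\gamma)=\alpha\sum_{x\in\Lambda_L}\|\gamma_x\|+\lambda\sum_{x\in\Lambda_L}\Big(\Big(\sum_{y\in\Lambda_L}\mathbf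 1\{x\in\gamma_y\}-1\Big)\vee 0\Big)+\sum_{x\in\Lambda_L:\,\|\gamma_x\|>0}\log\|\gamma_x\| ,$$ with expectation $\mathbb E_{L,\alpha,\lambda}$. Let $\mathrm{SAP}(n)$ be the set of self-avoiding polygons on $\mathbb Z^d$ that cover exactly $n$ vertices and contain the origin. Then the connective constant $$\mu=\lim_{n\to\infty,\ n\text{ even}}|\mathrm{SAP}(n)|^{1/n}\in(0,\infty)$$ exists, and for all $\alpha,\lambda\in\mathbb R$: (i) if $\alpha+\lambda>\log\mu$, then $\limsup_{L\to\infty}\mathbb E_{L,\alpha,\lambda}(\|\gamma_o\|)<\infty$; (ii) if $\alpha+\lambda<\log\mu$, then $\limsup_{L\to\infty}\mathbb E_{L,\alpha,\lambda}(\|\gamma_o\|)=\infty$. -/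

import Mathlib

open Filter Topology

namespace ISAP

/-- The nearest-neighbour graph on `R ^ d`. For `R = ℤ` this is the lattice `ℤ ^ d`; for
`R = ZMod L` (`L ≥ 1`) it is the torus of side length `L`, the box
`[-L/2, L/2) ^ d ∩ ℤ ^ d` with periodic boundary conditions. Each undirected edge stands for the
two directed edges between its end points. -/
def latticeGraph (d : ℕ) (R : Type) [Ring R] : SimpleGraph (Fin d → R) :=
  SimpleGraph.fromRel fun x y => ∃ i : Fin d, y = x + Pi.single i 1

/-- A directed self-avoiding polygon in `G`, possibly empty: a finite connected directed subgraph
of `G` in which each vertex has exactly one outgoing and exactly one ingoing edge. -/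
@[ext]
structure Polygon {V : Type} (G : SimpleGraph V) where
  /-- the vertices of the polygon -/
  verts : Finset V
  /-- the directed edges of the polygon, `(v, w)` being directed from `v` to `w` -/
  edges : Finset (V × V)
  adj_of_mem : ∀ e ∈ edges, G.Adj e.1 e.2
  fst_mem : ∀ e ∈ edges, e.1 ∈ verts
  snd_mem : ∀ e ∈ edges, e.2 ∈ verts
  existsUnique_out : ∀ v ∈ verts, ∃! w, (v, w) ∈ edges
  existsUnique_in : ∀ v ∈ verts, ∃! w, (w, v) ∈ edges
  connected : ∀ v ∈ verts, ∀ w ∈ verts, Relation.EqvGen (fun a b => (a, b) ∈ edges) v w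

/-- The length `‖γ‖` of a polygon: its number of edges. -/
def Polygon.length {V : Type} {G : SimpleGraph V} (γ : Polygon G) : ℕ := γ.edges.card

instance {V : Type} [Finite V] (G : SimpleGraph V) : Finite (Polygon G) := by
  refine Finite.of_injective (β := Finset V × Finset (V × V)) (fun γ => (γ.verts, γ.edges)) ?_
  intro γ γ' h
  exact Polygon.ext (congrArg Prod.fst h) (congrArg Prod.snd h)

/-- The polygons on `ℤ ^ d` covering `n` vertices and containing the origin. -/
def originPolygons (d n : ℕ) : Set (Polygon (latticeGraph d ℤ)) :=
  {γ | (0 : Fin d → ℤ) ∈ γ.verts ∧ γ.verts.card = n}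

/-- `μ` is the connective constant of self-avoiding polygons on `ℤ ^ d`: the limit of
`|SAP(n)| ^ (1 / n)`, taken along even `n`, because there are no polygons of odd length
on `ℤ ^ d`. -/
def IsConnectiveConstant (d : ℕ) (μ : ℝ) : Prop :=
  Tendsto (fun k : ℕ => ((originPolygons d (2 * k)).ncard : ℝ) ^ (1 / ((2 * k : ℕ) : ℝ)))
    atTop (𝓝 μ)

/-- The vertices of the `d`-dimensional torus of side length `L`. -/
abbrev Torus (d L : ℕ) : Type := Fin d → ZMod L

/-- The polygons on the torus that contain `x`, together with the empty polygon. -/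
abbrev PolygonAt (d L : ℕ) (x : Torus d L) : Type :=
  {γ : Polygon (latticeGraph d (ZMod L)) // γ.verts = ∅ ∨ x ∈ γ.verts}

/-- The configurations: one (possibly empty) polygon for each vertex of the torus. -/
abbrev Config (d L : ℕ) : Type := (x : Torus d L) → PolygonAt d L x

noncomputable section

variable {d L : ℕ} [NeZero L]

instance : Fintype (Config d L) := Fintype.ofFinite _

/-- The cumulative length of a configuration. -/
def cumulativeLength (γ : Config d L) : ℝ := ∑ x, ((γ x).1.length : ℝ)

open Classical in
/-- The total overlap of a configuration. -/
def overlap (γ : Config d L) : ℝ :=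
  ∑ x : Torus d L, max ((∑ y : Torus d L, if x ∈ (γ y).1.verts then (1 : ℝ) else 0) - 1) 0

/-- The energy of a configuration. -/
def energy (α lam : ℝ) (γ : Config d L) : ℝ :=
  α * cumulativeLength γ + lam * overlap γ +
    ∑ x : Torus d L with 0 < (γ x).1.length, Real.log ((γ x).1.length : ℝ)

variable (d L) in
/-- The partition function. -/
def partitionFunction (α lam : ℝ) : ℝ := ∑ γ : Config d L, Real.exp (-energy α lam γ)

/-- The probability of a configuration. -/
def prob (α lam : ℝ) (γ : Config d L) : ℝ :=
  Real.exp (-energy α lam γ) / partitionFunction d L α lam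

variable (d L) in
/-- The expected length of the polygon attached to the origin. -/
def expectedLength (α lam : ℝ) : ℝ :=
  ∑ γ : Config d L, prob α lam γ * ((γ 0).1.length : ℝ)

end

/-- The limit superior, as the side length of the torus tends to infinity, of the expected length
of the polygon attached to the origin. The side length is written as `n + 1` because it is
positive. -/
noncomputable def limsupExpectedLength (d : ℕ) (α lam : ℝ) : EReal :=
  limsup (fun n : ℕ => ((expectedLength d (n + 1) α lam : ℝ) : EReal)) atTop

end ISAP

/-! Up to factors exponential in the volume the polygons are independent. The vertex counts sum to
the cumulative length and `(m - 1) ∨ 0` lies between `m - 1` and `m`, so replacing the overlap by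
the cumulative length changes the energy by at most `|lam|` per site (`overlap_bounds`,
`exp_neg_energy_bounds`). The product measure that results has one parameter, `b = α + lam`, and
one-site partition function `polygonSum d L b`. Jensen's inequality for `exp (t * cumulativeLength)`
together with translation invariance bounds `t` times the expected length by `2 * |lam| + log
polygonSum (b - t) - log polygonSum b` (`mul_expectedLength_le`). A small positive `t` gives the
upper bound above `log μ`. A negative `t` that moves `b - t` above `log μ` gives divergence below,
once `polygonSum` is known to be bounded in `L` above `log μ` and to diverge below it.

This reduces the theorem to counting: the constant `μ` must exist and must also bound the number of
polygons on the torus, uniformly in `L` and up to a polynomial factor. Short lattice polygons embed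
in the torus. Conversely, a torus polygon lifts either to a lattice loop or, if it winds around, to
a walk whose periodic repetition is self-avoiding (`IsLoop.lift`).

Both kinds are compared with pairs of bridges of equal displacement. Such pairs concatenate
injectively, so their number is supermultiplicative and Fekete's lemma gives `μ` with the bound `μ ^
n` for every `n`. A loop cut at its lowest and highest vertices is a pair of bridges. In the other
direction, bridges repeat periodically, and two periodic walks with the same displacement can be
rotated to opposite sides of a hyperplane and closed up into a loop (`exists_isLoop_join`); this
needs `d ≥ 2`. By Cauchy–Schwarz over the polynomially many displacements, the square of the number
of periodic walks of length `n` is at most a polynomial times the number of loops of length `2 * n +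
2`, so winding polygons grow at rate at most `μ` as well. -/

namespace ISAP

/-! ### Walks as words of steps: loops, joins and bridges. -/

section Words

variable {d : ℕ}

/-- A nearest-neighbour step: a coordinate direction and a sign. -/
abbrev Step (d : ℕ) : Type := Fin d × Bool

/-- The lattice vector of a step. -/
def vec (s : Step d) : Fin d → ℤ := if s.2 then Pi.single s.1 1 else -Pi.single s.1 1

/-- The reversed step. -/
def opp (s : Step d) : Step d := (s.1, !s.2)

/-- The total displacement of a word of steps. -/
def disp (w : List (Step d)) : Fin d → ℤ := (w.map vec).sum

/-- The word that walks back along `w`. -/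
def rev (w : List (Step d)) : List (Step d) := (w.map opp).reverse

@[simp] lemma vec_opp (s : Step d) : vec (opp s) = -vec s := by
  rcases s with ⟨i, b⟩; cases b <;> simp [vec, opp]

@[simp] lemma opp_opp (s : Step d) : opp (opp s) = s := by simp [opp]

@[simp] lemma disp_nil : disp ([] : List (Step d)) = 0 := rfl

@[simp] lemma disp_cons (s : Step d) (w : List (Step d)) : disp (s :: w) = vec s + disp w := by
  simp [disp]

@[simp] lemma disp_append (a b : List (Step d)) : disp (a ++ b) = disp a + disp b := by
  simp [disp]

@[simp] lemma rev_nil : rev ([] : List (Step d)) = [] := rfl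

@[simp] lemma length_rev (w : List (Step d)) : (rev w).length = w.length := by simp [rev]

@[simp] lemma rev_rev (w : List (Step d)) : rev (rev w) = w := by
  simp [rev, Function.comp_def]

@[simp] lemma rev_append (a b : List (Step d)) : rev (a ++ b) = rev b ++ rev a := by
  simp [rev]

@[simp] lemma disp_rev (w : List (Step d)) : disp (rev w) = -disp w := by
  induction w with
  | nil => simp
  | cons s w ih =>
    have : rev (s :: w) = rev w ++ [opp s] := by simp [rev]
    rw [this, disp_append, ih]; simp

lemma rev_injective : Function.Injective (rev : List (Step d) → List (Step d)) :=
  Function.LeftInverse.injective rev_rev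

lemma rev_eq_nil {w : List (Step d)} : rev w = [] ↔ w = [] := by
  rw [← List.length_eq_zero_iff, length_rev, List.length_eq_zero_iff]

lemma infix_rev {u w : List (Step d)} (h : u <:+: rev w) : rev u <:+: w := by
  obtain ⟨s, t, h⟩ := h
  refine ⟨rev t, rev s, ?_⟩
  rw [← rev_rev w, ← h]; simp

lemma prefix_rev {u w : List (Step d)} (h : u <+: rev w) : rev u <:+ w := by
  obtain ⟨t, h⟩ := h
  exact ⟨rev t, by rw [← rev_rev w, ← h]; simp⟩

lemma suffix_rev {u w : List (Step d)} (h : u <:+ rev w) : rev u <+: w := by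
  obtain ⟨t, h⟩ := h
  exact ⟨rev t, by rw [← rev_rev w, ← h]; simp⟩

lemma prefix_append_cases {α : Type*} {p a b : List α} (h : p <+: a ++ b) :
    p <+: a ∨ ∃ q, p = a ++ q ∧ q <+: b := by
  obtain ⟨t, ht⟩ := h
  rcases List.append_eq_append_iff.mp ht with ⟨as, h1, _⟩ | ⟨bs, h1, h2⟩
  · exact Or.inl ⟨as, h1.symm⟩
  · exact Or.inr ⟨bs, h1, ⟨t, h2.symm⟩⟩

lemma suffix_append_cases {α : Type*} {p a b : List α} (h : p <:+ a ++ b) :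
    p <:+ b ∨ ∃ q, p = q ++ b ∧ q <:+ a := by
  obtain ⟨t, ht⟩ := h
  rcases List.append_eq_append_iff.mp ht with ⟨as, h1, h2⟩ | ⟨bs, h1, h2⟩
  · exact Or.inr ⟨as, h2, ⟨t, h1.symm⟩⟩
  · exact Or.inl ⟨bs, h2.symm⟩

lemma vec_injective : Function.Injective (vec : Step d → Fin d → ℤ) := by
  rintro ⟨i, b⟩ ⟨j, c⟩ h
  have hi := congrFun h i
  by_cases hij : i = j
  · subst hij
    cases b <;> cases c <;> first | rfl | simp [vec] at hi
  · cases b <;> cases c <;> simp [vec, hij] at hi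

lemma abs_vec_le (s : Step d) (i : Fin d) : |vec s i| ≤ 1 := by
  rcases s with ⟨j, b⟩
  by_cases hij : i = j <;> cases b <;> simp [vec, hij]

lemma abs_disp_le (w : List (Step d)) (i : Fin d) : |disp w i| ≤ w.length := by
  induction w with
  | nil => simp
  | cons s w ih =>
    have := abs_vec_le s i
    have h2 := abs_add_le (vec s i) (disp w i)
    simp only [disp_cons, Pi.add_apply, List.length_cons, Nat.cast_add, Nat.cast_one]
    linarith

/-- The words none of whose nonempty factors is closed: the self-avoiding walks. -/
def SAW (w : List (Step d)) : Prop := ∀ u, u <:+: w → u ≠ [] → disp u ≠ 0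

lemma SAW.of_infix {u w : List (Step d)} (hw : SAW w) (h : u <:+: w) : SAW u :=
  fun v hv => hw v (hv.trans h)

lemma SAW.rev {w : List (Step d)} (hw : SAW w) : SAW (rev w) := by
  intro u hu hne h0
  exact hw _ (infix_rev hu) (by rwa [Ne, rev_eq_nil]) (by simp [h0])

/-- Words which, after projecting displacements along `f`, trace a self-avoiding closed path. -/
def IsLoop {M : Type*} [AddCommGroup M] (f : (Fin d → ℤ) →+ M) (w : List (Step d)) : Prop :=
  f (disp w) = 0 ∧ ∀ u, u <:+: w → u ≠ [] → u.length < w.length → f (disp u) ≠ 0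

/-- A factor crossing the new seam is the complement of a factor of the original word, and the two
displacements cancel because the word is closed. -/
lemma IsLoop.rotate {M : Type*} [AddCommGroup M] {f : (Fin d → ℤ) →+ M} {p q : List (Step d)}
    (h : IsLoop f (p ++ q)) : IsLoop f (q ++ p) := by
  refine ⟨?_, ?_⟩
  · have := h.1
    rw [disp_append] at this ⊢
    rwa [add_comm]
  · intro u hu hne hlen h0
    rcases List.infix_append_iff.mp hu with hu | hu | ⟨s, t, rfl, hs, ht⟩
    · exact h.2 u (List.infix_append_of_infix_right hu) hne
        (by simp only [List.length_append] at hlen ⊢; omega) h0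
    · exact h.2 u (List.infix_append_of_infix_left hu) hne
        (by simp only [List.length_append] at hlen ⊢; omega) h0
    · obtain ⟨q', rfl⟩ := hs
      obtain ⟨p', rfl⟩ := ht
      have hpos : 0 < (s ++ t).length := List.length_pos_iff.mpr hne
      refine h.2 (p' ++ q') ⟨t, s, by simp⟩ ?_ ?_ ?_
      · rw [← List.length_pos_iff]
        simp only [List.length_append] at hlen ⊢; omega
      · simp only [List.length_append] at hlen hpos ⊢; omega
      · have h1 := h.1
        simp only [disp_append, map_add] at h1 h0 ⊢
        have : f (disp p') + f (disp q') =
          (f (disp t) + f (disp p') + (f (disp q') + f (disp s))) - (f (disp s) + f (disp t)) := by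
          abel
        rw [this, h1, h0, sub_zero]

lemma IsLoop.rotate' {M : Type*} [AddCommGroup M] {f : (Fin d → ℤ) →+ M} {w : List (Step d)}
    (h : IsLoop f w) {r : ℕ} (hr : r ≤ w.length) : IsLoop f (w.rotate r) := by
  rw [List.rotate_eq_drop_append_take hr]
  apply IsLoop.rotate
  rwa [List.take_append_drop]

lemma infix_rotate {α : Type*} {w : List α} {r : ℕ} (hr : r ≤ w.length) :
    w.rotate r <:+: w ++ w := by
  rw [List.rotate_eq_drop_append_take hr]
  refine ⟨w.take r, w.drop r, ?_⟩
  rw [← List.append_assoc, List.take_append_drop, List.append_assoc, List.take_append_drop]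

lemma disp_rotate (w : List (Step d)) {r : ℕ} (hr : r ≤ w.length) :
    disp (w.rotate r) = disp w := by
  rw [List.rotate_eq_drop_append_take hr, disp_append, add_comm, ← disp_append,
    List.take_append_drop]

/-- A word whose displacement lies in the kernel of `φ` can be rotated to start at a vertex
where `φ` is minimal. -/
lemma exists_rotate_nonneg (φ : (Fin d → ℤ) →+ ℤ) (w : List (Step d)) (hw : w ≠ [])
    (h : φ (disp w) = 0) : ∃ r < w.length, ∀ p, p <+: w.rotate r → 0 ≤ φ (disp p) := by
  have hpos : 0 < w.length := List.length_pos_iff.mpr hw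
  obtain ⟨r, hr, hmin⟩ := Finset.exists_min_image (Finset.range w.length)
    (fun i => φ (disp (w.take i))) ⟨0, by simpa using hpos⟩
  rw [Finset.mem_range] at hr
  have key : ∀ q, q <+: w → φ (disp (w.take r)) ≤ φ (disp q) := by
    intro q hq
    rcases hq.length_le.lt_or_eq with hl | hl
    · have := hmin q.length (by simpa using hl)
      rwa [← List.prefix_iff_eq_take.mp hq] at this
    · rw [hq.eq_of_length hl, h]
      simpa using hmin 0 (by simpa using hpos)
  refine ⟨r, hr, fun p hp => ?_⟩
  rw [List.rotate_eq_drop_append_take hr.le] at hp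
  rcases prefix_append_cases hp with hp | ⟨q, rfl, hq⟩
  · have := key (w.take r ++ p) (by
      obtain ⟨t, ht⟩ := hp
      exact ⟨t, by rw [List.append_assoc, ht, List.take_append_drop]⟩)
    rw [disp_append, map_add] at this
    linarith
  · have h1 := key q (hq.trans (List.take_prefix _ _))
    have h2 : φ (disp (w.take r)) + φ (disp (w.drop r)) = 0 := by
      rw [← map_add, ← disp_append, List.take_append_drop, h]
    rw [disp_append, map_add]
    linarith

/-- Two walks with the same end points that lie on the two sides of a hyperplane through the end
points can be joined to a closed loop. -/
lemma isLoop_join (φ : (Fin d → ℤ) →+ ℤ) {a b : List (Step d)} {e : Step d} (ha : SAW a)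
    (hb : SAW b) (hne : a ≠ []) (hab : disp a = disp b) (hφ : φ (disp a) = 0)
    (he : 0 < φ (vec e)) (hpa : ∀ p, p <+: a → φ (disp p) ≤ 0)
    (hpb : ∀ p, p <+: b → 0 ≤ φ (disp p)) :
    IsLoop (AddMonoidHom.id _) ((a ++ [e]) ++ (rev b ++ [opp e])) := by
  have hsa : ∀ s, s <:+ a → 0 ≤ φ (disp s) := by
    rintro s ⟨t, rfl⟩
    have := hpa t (List.prefix_append _ _)
    simp only [disp_append, map_add] at hφ
    linarith
  have hφb : φ (disp b) = 0 := by rw [← hab, hφ]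
  have hprb : ∀ p, p <+: rev b → 0 ≤ φ (disp p) := by
    intro p hp
    obtain ⟨t, ht⟩ := prefix_rev hp
    have := hpb t ⟨_, ht⟩
    rw [← ht, disp_append, disp_rev, map_add, map_neg] at hφb
    linarith
  have hsrb : ∀ s, s <:+ rev b → φ (disp s) ≤ 0 := by
    intro s hs
    have := hpb _ (suffix_rev hs)
    rw [disp_rev, map_neg] at this
    linarith
  refine ⟨by simp [hab], ?_⟩
  simp only [AddMonoidHom.id_apply]
  intro u hu hne' hlen h0
  have h0φ : φ (disp u) = 0 := by rw [h0, map_zero]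
  -- A factor inside `a` or `rev b` is not closed by self-avoidance. One with exactly one of the two
  -- connecting steps changes `φ` strictly, since the rest of it has the same sign.
  rcases List.infix_append_iff.mp hu with hu | hu | ⟨s, t, rfl, hs, ht⟩
  · rcases List.infix_concat_iff.mp hu with hu | hu
    · rcases List.suffix_concat_iff.mp hu with rfl | ⟨t, rfl, ht⟩
      · exact hne' rfl
      · have := hsa t ht
        simp only [disp_append, disp_cons, disp_nil, add_zero, map_add] at h0φ
        linarith
    · exact ha u hu hne' h0
  · rcases List.infix_concat_iff.mp hu with hu | hu
    · rcases List.suffix_concat_iff.mp hu with rfl | ⟨t, rfl, ht⟩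
      · exact hne' rfl
      · have := hsrb t ht
        simp only [disp_append, disp_cons, disp_nil, add_zero, map_add, vec_opp, map_neg] at h0φ
        linarith
    · exact hb.rev u hu hne' h0
  · rcases List.suffix_concat_iff.mp hs with rfl | ⟨s', rfl, hs'⟩
    · rw [List.nil_append] at h0 h0φ hne'
      rcases List.prefix_concat_iff.mp ht with rfl | ht
      · simp only [disp_append, disp_rev, disp_cons, disp_nil, add_zero, map_add, vec_opp,
          map_neg] at h0φ
        linarith
      · exact hb.rev t ht.isInfix hne' h0
    · rcases List.prefix_concat_iff.mp ht with rfl | ht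
      -- The factor contains both connecting steps, so its complement is a prefix of `a` that would
      -- have to be closed.
      · obtain ⟨p, rfl⟩ := hs'
        refine ha p (List.infix_append [] p s') ?_ ?_
        · rintro rfl
          simp at hlen
        · simp only [disp_append, disp_rev, disp_cons, disp_nil, add_zero, vec_opp, ← hab] at h0
          have : disp p = -(disp s' + vec e + (-(disp p + disp s') + -vec e)) := by abel
          rw [this, h0, neg_zero]
      · have h1 := hsa s' hs'
        have h2 := hprb t ht
        simp only [disp_append, disp_cons, disp_nil, add_zero, map_add] at h0φ
        linarith

/-- Bridges in the direction of `g`. -/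
structure IsBridge (g : (Fin d → ℤ) →+ ℤ) (w : List (Step d)) : Prop where
  saw : SAW w
  pos_of_prefix : ∀ p, p <+: w → p ≠ [] → 0 < g (disp p)
  nonneg_of_suffix : ∀ s, s <:+ w → 0 ≤ g (disp s)

/-- A factor across the junction is a suffix of `a`, of height at least zero, followed by a nonempty
prefix of `b`, of positive height. One strict and one weak inequality are exactly what concatenation
needs. -/
lemma IsBridge.append {g : (Fin d → ℤ) →+ ℤ} {a b : List (Step d)} (ha : IsBridge g a)
    (hb : IsBridge g b) : IsBridge g (a ++ b) where
  saw := by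
    intro u hu hne h0
    rcases List.infix_append_iff_ne_nil.mp hu with hu | hu | ⟨s, t, hs0, ht0, rfl, hs, ht⟩
    · exact ha.saw u hu hne h0
    · exact hb.saw u hu hne h0
    · have h1 := ha.nonneg_of_suffix s hs
      have h2 := hb.pos_of_prefix t ht ht0
      have h3 : g (disp (s ++ t)) = 0 := by rw [h0, map_zero]
      rw [disp_append, map_add] at h3
      linarith
  pos_of_prefix := by
    intro p hp hne
    rcases prefix_append_cases hp with hp | ⟨q, rfl, hq⟩
    · exact ha.pos_of_prefix p hp hne
    · have h1 := ha.nonneg_of_suffix a List.suffix_rfl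
      rw [disp_append, map_add]
      by_cases hq0 : q = []
      · subst hq0
        simpa using ha.pos_of_prefix a List.prefix_rfl (by simpa using hne)
      · have := hb.pos_of_prefix q hq hq0
        linarith
  nonneg_of_suffix := by
    intro s hs
    rcases suffix_append_cases hs with hs | ⟨q, rfl, hq⟩
    · exact hb.nonneg_of_suffix s hs
    · have h1 := hb.nonneg_of_suffix b List.suffix_rfl
      have := ha.nonneg_of_suffix q hq
      rw [disp_append, map_add]
      linarith

lemma isBridge_nil (g : (Fin d → ℤ) →+ ℤ) : IsBridge g [] where
  saw := by intro u hu hne; simp_all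
  pos_of_prefix := by intro u hu hne; simp_all
  nonneg_of_suffix := by intro u hu; simp_all

lemma isBridge_singleton {g : (Fin d → ℤ) →+ ℤ} {e : Step d} (he : 0 < g (vec e)) :
    IsBridge g [e] where
  saw := by
    intro u hu hne h0
    have h := hu.length_le
    have hu1 : u = [e] := hu.eq_of_length (le_antisymm h (by
      simpa using Nat.one_le_iff_ne_zero.mpr (by simpa using hne)))
    subst hu1
    have h0 : vec e = 0 := by simpa using h0
    simp [h0] at he
  pos_of_prefix := by
    intro p hp hne
    have := List.prefix_cons_iff.mp hp
    rcases this with rfl | ⟨t, rfl, ht⟩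
    · exact absurd rfl hne
    · simp_all
  nonneg_of_suffix := by
    intro s hs
    rcases List.suffix_cons_iff.mp hs with rfl | hs
    · simpa using he.le
    · simp_all

/-- Cutting a loop at a vertex minimizing `g` and at a vertex maximizing `g` yields two bridges,
after adding one step to each. -/
lemma IsLoop.isBridge_cons {g : (Fin d → ℤ) →+ ℤ} {e : Step d} {A C : List (Step d)}
    (h : IsLoop (AddMonoidHom.id _) (A ++ C)) (hC : C ≠ [])
    (hmin : ∀ p, p <+: A ++ C → 0 ≤ g (disp p))
    (hmax : ∀ p, p <+: A → g (disp p) ≤ g (disp A)) (he : 0 < g (vec e)) :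
    IsBridge g (e :: A) where
  saw := by
    have hA : SAW A := fun u hu hne =>
      h.2 u (List.infix_append_of_infix_left hu) hne (by
        have := hu.length_le
        have := List.length_pos_iff.mpr hC
        simp only [List.length_append]; omega)
    intro u hu hne h0
    -- The loop never goes below its start, so any factor beginning with the added step has positive
    -- height; the added step makes the lower inequality strict.
    rcases List.infix_cons_iff.mp hu with hu | hu
    · rcases List.prefix_cons_iff.mp hu with rfl | ⟨t, rfl, ht⟩
      · exact hne rfl
      · have h1 := hmin t (ht.trans (List.prefix_append _ _))
        have h2 : g (disp (e :: t)) = 0 := by rw [h0, map_zero]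
        rw [disp_cons, map_add] at h2
        linarith
    · exact hA u hu hne h0
  pos_of_prefix := by
    intro p hp hne
    rcases List.prefix_cons_iff.mp hp with rfl | ⟨t, rfl, ht⟩
    · exact absurd rfl hne
    · have h1 := hmin t (ht.trans (List.prefix_append _ _))
      rw [disp_cons, map_add]
      linarith
  nonneg_of_suffix := by
    intro s hs
    rcases List.suffix_cons_iff.mp hs with rfl | hs
    · have h1 := hmin A (List.prefix_append _ _)
      rw [disp_cons, map_add]
      linarith
    · obtain ⟨t, rfl⟩ := hs
      have := hmax t (List.prefix_append _ _)
      rw [disp_append, map_add] at this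
      linarith

end Words

end ISAP

namespace ISAP

/-! ### Polynomial comparison of loops, bridge pairs and periodic pairs. -/

section Counting

variable {d : ℕ}

/-- In dimension at least two a nonzero vector lies in a coordinate hyperplane or in a tilted one:
eliminate coordinate `j` against a nonzero coordinate `i`. The sign factor makes the value at the
unit vector `j` equal to `|y i| > 0`. -/
lemma exists_separating_functional (hd : 2 ≤ d) {y : Fin d → ℤ} (hy : y ≠ 0) :
    ∃ (φ : (Fin d → ℤ) →+ ℤ) (e : Step d), φ y = 0 ∧ 0 < φ (vec e) := by
  obtain ⟨i, hi⟩ := Function.ne_iff.mp hy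
  have : Nontrivial (Fin d) := Fin.nontrivial_iff_two_le.mpr hd
  obtain ⟨j, hj⟩ := exists_ne i
  refine ⟨AddMonoidHom.mk' (fun x => |y i| * x j - (y i).sign * y j * x i) ?_, (j, true), ?_, ?_⟩
  · intro a b
    simp only [Pi.add_apply]
    ring
  · simp only [AddMonoidHom.mk'_apply]
    rw [← Int.sign_mul_self_eq_abs]
    ring
  · simpa [vec, hj.symm] using hi

/-- Choose `φ` vanishing on the common displacement. Start `a` at its `φ`-highest vertex and `b` at
its `φ`-lowest one, so that the hyperplane separates them. Rotations of `a` are factors of `a ++ a`,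
hence still self-avoiding. -/
lemma exists_isLoop_join (hd : 2 ≤ d) {a b : List (Step d)} (hane : a ≠ []) (hbne : b ≠ [])
    (ha : SAW (a ++ a)) (hb : SAW (b ++ b)) (hab : disp a = disp b) :
    ∃ r < a.length, ∃ r' < b.length, ∃ e : Step d,
      IsLoop (AddMonoidHom.id _) ((a.rotate r ++ [e]) ++ (rev (b.rotate r') ++ [opp e])) := by
  have hy : disp a ≠ 0 := ha a ⟨[], a, by simp⟩ hane
  obtain ⟨φ, e, hφ, he⟩ := exists_separating_functional hd hy
  obtain ⟨r, hr, hra⟩ := exists_rotate_nonneg (-φ) a hane (by simp [hφ])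
  obtain ⟨r', hr', hrb⟩ := exists_rotate_nonneg φ b hbne (by rw [← hab, hφ])
  refine ⟨r, hr, r', hr', e, isLoop_join φ (ha.of_infix (infix_rotate hr.le))
    (hb.of_infix (infix_rotate hr'.le)) ?_ ?_ ?_ he ?_ hrb⟩
  · simpa using hane
  · rw [disp_rotate _ hr.le, disp_rotate _ hr'.le, hab]
  · rw [disp_rotate _ hr.le, hφ]
  · intro p hp
    have := hra p hp
    rw [AddMonoidHom.neg_apply] at this
    linarith

/-- The loops of length `n`. -/
def loopWords {M : Type*} [AddCommGroup M] (f : (Fin d → ℤ) →+ M) (n : ℕ) : Set (List (Step d)) :=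
  {w | w.length = n ∧ IsLoop f w}

/-- The pairs of bridges with common displacement and total length `n`. -/
def bridgePairs (g : (Fin d → ℤ) →+ ℤ) (n : ℕ) : Set (List (Step d) × List (Step d)) :=
  {p | p.1.length + p.2.length = n ∧ disp p.1 = disp p.2 ∧ IsBridge g p.1 ∧ IsBridge g p.2}

/-- The pairs of words with common displacement and total length `n` whose periodic repetitions
are self-avoiding. -/
def periodicPairs (d n : ℕ) : Set (List (Step d) × List (Step d)) :=
  {p | p.1.length + p.2.length = n ∧ disp p.1 = disp p.2 ∧ p.1 ≠ [] ∧ p.2 ≠ [] ∧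
    SAW (p.1 ++ p.1) ∧ SAW (p.2 ++ p.2)}

lemma finite_loopWords {M : Type*} [AddCommGroup M] (f : (Fin d → ℤ) →+ M) (n : ℕ) :
    (loopWords f n).Finite :=
  (List.finite_length_eq (Step d) n).subset fun _ hw => hw.1

lemma finite_pairs (d n : ℕ) :
    {p : List (Step d) × List (Step d) | p.1.length + p.2.length = n}.Finite := by
  refine ((List.finite_length_le (Step d) n).prod (List.finite_length_le (Step d) n)).subset ?_
  rintro ⟨a, b⟩ h
  simp only [Set.mem_ofPred_eq, Set.mem_prod] at h ⊢
  omega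

lemma finite_bridgePairs (g : (Fin d → ℤ) →+ ℤ) (n : ℕ) : (bridgePairs g n).Finite :=
  (finite_pairs d n).subset fun _ h => h.1

lemma finite_periodicPairs (n : ℕ) : (periodicPairs d n).Finite :=
  (finite_pairs d n).subset fun _ h => h.1

lemma ncard_range (n : ℕ) : (↑(Finset.range n) : Set ℕ).ncard = n := by
  rw [Set.ncard_coe_finset, Finset.card_range]

/-- The joined loop, the length of the first word and the two rotation amounts determine the pair.
The connecting step need not be recorded, and it and its reverse account for the `+ 2`. -/
lemma ncard_periodicPairs_le (hd : 2 ≤ d) (n : ℕ) :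
    (periodicPairs d n).ncard ≤
      (n + 1) * (n * (n * (loopWords (AddMonoidHom.id (Fin d → ℤ)) (n + 2)).ncard)) := by
  have key : ∀ p : List (Step d) × List (Step d), ∃ q : ℕ × ℕ × Step d, p ∈ periodicPairs d n →
      q.1 < p.1.length ∧ q.2.1 < p.2.length ∧ IsLoop (AddMonoidHom.id _)
        ((p.1.rotate q.1 ++ [q.2.2]) ++ (rev (p.2.rotate q.2.1) ++ [opp q.2.2])) := by
    intro p
    by_cases hp : p ∈ periodicPairs d n
    · obtain ⟨_, h2, h3, h4, h5, h6⟩ := hp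
      obtain ⟨r, hr, r', hr', e, h⟩ := exists_isLoop_join hd h3 h4 h5 h6 h2
      exact ⟨(r, r', e), fun _ => ⟨hr, hr', h⟩⟩
    · have : Nonempty (Fin d) := ⟨⟨0, by omega⟩⟩
      exact ⟨Classical.arbitrary _, fun h => absurd h hp⟩
  choose F hF using key
  have hfin := finite_loopWords (AddMonoidHom.id (Fin d → ℤ)) (n + 2)
  have := Set.ncard_le_ncard_of_injOn
    (s := periodicPairs d n)
    (t := (↑(Finset.range (n + 1)) : Set ℕ) ×ˢ ((↑(Finset.range n) : Set ℕ) ×ˢ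
      ((↑(Finset.range n) : Set ℕ) ×ˢ loopWords (AddMonoidHom.id (Fin d → ℤ)) (n + 2))))
    (fun p => (p.1.length, (F p).1, (F p).2.1,
      (p.1.rotate (F p).1 ++ [(F p).2.2]) ++ (rev (p.2.rotate (F p).2.1) ++ [opp (F p).2.2])))
    ?_ ?_
    ((Finset.finite_toSet _).prod ((Finset.finite_toSet _).prod
      ((Finset.finite_toSet _).prod hfin)))
  · simpa only [Set.ncard_prod, ncard_range] using this
  · intro p hp
    obtain ⟨h1, h2, h3⟩ := hF p hp
    have hl := hp.1
    simp only [Set.mem_prod, Finset.coe_range, Set.mem_Iio]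
    refine ⟨by omega, by omega, by omega, ?_, h3⟩
    simp only [List.length_append, List.length_rotate, length_rev, List.length_singleton]
    omega
  · intro p hp q hq hpq
    simp only [Prod.mk.injEq] at hpq
    obtain ⟨h1, h2, h3, h4⟩ := hpq
    have hpl := hp.1
    have hql := hq.1
    obtain ⟨h5, h6⟩ := List.append_inj h4 (by simp [h1])
    have h7 := List.append_inj_left h5 (by simp [h1])
    have h8 := List.append_inj_left h6 (by simp; omega)
    rw [h2] at h7
    rw [h3] at h8
    exact Prod.ext (List.rotate_injective _ h7) (List.rotate_injective _ (rev_injective h8))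

lemma bridgePairs_subset {g : (Fin d → ℤ) →+ ℤ} {n : ℕ} (hn : n ≠ 0) :
    bridgePairs g n ⊆ periodicPairs d n := by
  rintro ⟨a, b⟩ ⟨h1, h2, h3, h4⟩
  simp only at h1 h2 h3 h4
  refine ⟨h1, h2, ?_, ?_, (h3.append h3).saw, (h4.append h4).saw⟩
  · rintro rfl
    refine h4.saw b List.infix_rfl ?_ h2.symm
    rintro rfl
    simp at h1
    omega
  · rintro rfl
    refine h3.saw a List.infix_rfl ?_ h2
    rintro rfl
    simp at h1
    omega

lemma ncard_bridgePairs_le (hd : 2 ≤ d) (g : (Fin d → ℤ) →+ ℤ) {n : ℕ} (hn : n ≠ 0) :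
    (bridgePairs g n).ncard ≤
      (n + 1) * (n * (n * (loopWords (AddMonoidHom.id (Fin d → ℤ)) (n + 2)).ncard)) :=
  (Set.ncard_le_ncard (bridgePairs_subset hn) (finite_periodicPairs n)).trans
    (ncard_periodicPairs_le hd n)

/-- Moving the first cut forward moves the second one back by as many steps. Then `c` ends strictly
higher than `a`, while `e` ends strictly lower than `b`, contradicting the equal displacements
within each pair. -/
lemma bridgePairs_cut_aux {g : (Fin d → ℤ) →+ ℤ} {a b c e a' b' c' e' : List (Step d)}
    (hab : disp a = disp b) (hce : disp c = disp e)
    (ha' : IsBridge g a') (he' : IsBridge g e')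
    (h1 : a ++ a' = c ++ c') (h2 : b ++ b' = e ++ e')
    (hlen : a.length + b.length = c.length + e.length) : ¬ a.length < c.length := by
  intro hlt
  rcases List.append_eq_append_iff.mp h1 with ⟨t, rfl, ht⟩ | ⟨t, rfl, ht⟩
  · rcases List.append_eq_append_iff.mp h2 with ⟨s, rfl, hs⟩ | ⟨s, rfl, hs⟩
    · simp only [List.length_append] at hlen hlt
      omega
    · simp only [List.length_append] at hlen hlt
      have ht0 := ha'.pos_of_prefix t ⟨_, ht.symm⟩ (by rintro rfl; simp at hlt)
      have hs0 := he'.pos_of_prefix s ⟨_, hs.symm⟩ (by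
        intro h
        rw [h, List.length_nil] at hlen
        omega)
      have e1 := congrArg g hab
      have e2 := congrArg g hce
      simp only [disp_append, map_add] at e1 e2
      linarith
  · simp only [List.length_append] at hlt
    omega

/-- Concatenation in both components is injective although the individual lengths are not fixed:
`bridgePairs_cut_aux` forces the cut. -/
lemma ncard_bridgePairs_mul_le (g : (Fin d → ℤ) →+ ℤ) (n m : ℕ) :
    (bridgePairs g n).ncard * (bridgePairs g m).ncard ≤ (bridgePairs g (n + m)).ncard := by
  rw [← Set.ncard_prod]
  refine Set.ncard_le_ncard_of_injOn (fun p => (p.1.1 ++ p.2.1, p.1.2 ++ p.2.2)) ?_ ?_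
    (finite_bridgePairs g _)
  · rintro ⟨⟨a, b⟩, ⟨a', b'⟩⟩ ⟨⟨h1, h2, h3, h4⟩, ⟨h1', h2', h3', h4'⟩⟩
    simp only at h1 h2 h3 h4 h1' h2' h3' h4'
    refine ⟨?_, ?_, h3.append h3', h4.append h4'⟩
    · simp only [List.length_append]; omega
    · simp only [disp_append, h2, h2']
  · rintro ⟨⟨a, b⟩, ⟨a', b'⟩⟩ ⟨⟨h1, h2, h3, h4⟩, ⟨h1', h2', h3', h4'⟩⟩
      ⟨⟨c, e⟩, ⟨c', e'⟩⟩ ⟨⟨k1, k2, k3, k4⟩, ⟨k1', k2', k3', k4'⟩⟩ h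
    simp only [Prod.mk.injEq] at *
    obtain ⟨e1, e2⟩ := h
    have hl : a.length + b.length = c.length + e.length := by omega
    have n1 := bridgePairs_cut_aux h2 k2 h3' k4' e1 e2 hl
    have n2 := bridgePairs_cut_aux k2 h2 k3' h4' e1.symm e2.symm hl.symm
    obtain ⟨rfl, rfl⟩ := List.append_inj e1 (by omega)
    obtain ⟨rfl, rfl⟩ := List.append_inj e2 (by omega)
    simp

/-- Start at a lowest vertex and cut at a highest one. The two arcs, both walked upwards and
preceded by `e`, are bridges with the same end point. -/
lemma exists_bridges_of_isLoop (g : (Fin d → ℤ) →+ ℤ) {e : Step d} (he : 0 < g (vec e))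
    {w : List (Step d)} (hw : IsLoop (AddMonoidHom.id _) w) (hlen : 2 ≤ w.length) :
    ∃ r < w.length, ∃ k < w.length, (e :: (w.rotate r).take k, e :: rev ((w.rotate r).drop k)) ∈
      bridgePairs g (w.length + 2) := by
  have hd0 : disp w = 0 := hw.1
  obtain ⟨r, hr, hmin⟩ := exists_rotate_nonneg g w (by rintro rfl; simp at hlen) (by simp [hd0])
  set u := w.rotate r with hu
  have hul : u.length = w.length := List.length_rotate ..
  have hloop : IsLoop (AddMonoidHom.id _) u := hw.rotate' hr.le
  have hu0 : disp u = 0 := hloop.1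
  -- Excluding the end points keeps both arcs nonempty and loses nothing, since the height there is
  -- the minimum, zero.
  obtain ⟨k, hk, hmax⟩ := Finset.exists_max_image (Finset.Icc 1 (w.length - 1))
    (fun i => g (disp (u.take i))) ⟨1, by simp; omega⟩
  rw [Finset.mem_Icc] at hk
  have key : ∀ q, q <+: u → g (disp q) ≤ g (disp (u.take k)) := by
    intro q hq
    have hk0 := hmin _ (List.take_prefix k u)
    by_cases h0 : q.length = 0
    · rw [List.length_eq_zero_iff] at h0
      simpa [h0] using hk0
    · rcases hq.length_le.lt_or_eq with hl | hl
      · have := hmax q.length (by rw [Finset.mem_Icc]; omega)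
        rwa [← List.prefix_iff_eq_take.mp hq] at this
      · rw [hq.eq_of_length hl, hu0, map_zero]
        exact hk0
  have hsplit : u.take k ++ u.drop k = u := List.take_append_drop k u
  have hdisp : disp (u.take k) + disp (u.drop k) = 0 := by rw [← disp_append, hsplit, hu0]
  refine ⟨r, hr, k, by omega, ?_, ?_, ?_, ?_⟩
  · simp only [List.length_cons, length_rev, List.length_take, List.length_drop, List.length_rotate]
    omega
  · simp only [disp_cons, disp_rev]
    rw [eq_neg_of_add_eq_zero_left hdisp]
  · refine IsLoop.isBridge_cons (C := u.drop k) (by rwa [hsplit]) ?_ (by rwa [hsplit]) ?_ he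
    · rw [Ne, List.drop_eq_nil_iff]
      omega
    · exact fun p hp => key p (hp.trans (List.take_prefix _ _))
  · have hrev : rev (u.drop k) ++ rev (u.take k) = rev u := by rw [← rev_append, hsplit]
    have hsuf : ∀ t, t <:+ u → g (disp t) ≤ 0 := by
      rintro t ⟨s, hs⟩
      have h1 := hmin s ⟨t, hs⟩
      have h2 : g (disp s) + g (disp t) = 0 := by
        rw [← map_add, ← disp_append, hs, hu0, map_zero]
      linarith
    refine IsLoop.isBridge_cons (C := rev (u.take k)) ?_ ?_ ?_ ?_ he
    · rw [hrev]
      refine ⟨by simp [hu0], fun v hv hne hvl h0 => ?_⟩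
      rw [length_rev] at hvl
      refine hloop.2 _ (infix_rev hv) (by rwa [Ne, rev_eq_nil]) (by rwa [length_rev]) ?_
      simp only [AddMonoidHom.id_apply] at h0 ⊢
      rw [disp_rev, h0, neg_zero]
    · rw [Ne, rev_eq_nil, List.take_eq_nil_iff]
      rintro (h | h)
      · omega
      · rw [h] at hul
        simp at hul
        omega
    · rw [hrev]
      intro p hp
      have := hsuf _ (prefix_rev hp)
      rw [disp_rev, map_neg] at this
      linarith
    · intro p hp
      obtain ⟨t, ht⟩ := prefix_rev hp
      have h1 := key (u.take k ++ t) ⟨rev p, by rw [List.append_assoc, ht, hsplit]⟩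
      rw [disp_append, map_add] at h1
      rw [← ht]
      simp only [disp_append, disp_rev, neg_add, neg_neg, map_add, map_neg]
      linarith

lemma ncard_loopWords_le (g : (Fin d → ℤ) →+ ℤ) {e : Step d} (he : 0 < g (vec e)) {n : ℕ}
    (hn : 2 ≤ n) : (loopWords (AddMonoidHom.id (Fin d → ℤ)) n).ncard ≤
      n * (n * (bridgePairs g (n + 2)).ncard) := by
  have key : ∀ w : List (Step d), ∃ q : ℕ × ℕ, w ∈ loopWords (AddMonoidHom.id _) n →
      q.1 < n ∧ q.2 < n ∧
        (e :: (w.rotate q.1).take q.2, e :: rev ((w.rotate q.1).drop q.2)) ∈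
          bridgePairs g (n + 2) := by
    intro w
    by_cases hw : w ∈ loopWords (AddMonoidHom.id _) n
    · obtain ⟨rfl, h⟩ := hw
      obtain ⟨r, hr, k, hk, hb⟩ := exists_bridges_of_isLoop g he h hn
      exact ⟨(r, k), fun _ => ⟨hr, hk, hb⟩⟩
    · exact ⟨0, fun h => absurd h hw⟩
  choose F hF using key
  have := Set.ncard_le_ncard_of_injOn (s := loopWords (AddMonoidHom.id (Fin d → ℤ)) n)
    (t := (↑(Finset.range n) : Set ℕ) ×ˢ ((↑(Finset.range n) : Set ℕ) ×ˢ bridgePairs g (n + 2)))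
    (fun w => ((F w).1, (F w).2,
      (e :: (w.rotate (F w).1).take (F w).2, e :: rev ((w.rotate (F w).1).drop (F w).2))))
    ?_ ?_
    ((Finset.finite_toSet _).prod ((Finset.finite_toSet _).prod (finite_bridgePairs g _)))
  · simpa only [Set.ncard_prod, ncard_range] using this
  · intro w hw
    obtain ⟨h1, h2, h3⟩ := hF w hw
    simp only [Set.mem_prod, Finset.coe_range, Set.mem_Iio]
    exact ⟨h1, h2, h3⟩
  · intro w hw w' hw' h
    simp only [Prod.mk.injEq, List.cons.injEq, true_and] at h
    obtain ⟨h1, h2, h3, h4⟩ := h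
    have h5 := rev_injective h4
    rw [← h1, ← h2] at h3 h5
    have : w.rotate (F w).1 = w'.rotate (F w).1 := by
      rw [← List.take_append_drop (F w).2 (w.rotate (F w).1), h3, h5, List.take_append_drop]
    exact List.rotate_injective _ this

lemma one_le_ncard_bridgePairs (g : (Fin d → ℤ) →+ ℤ) {e : Step d} (he : 0 < g (vec e)) (n : ℕ) :
    1 ≤ (bridgePairs g (2 * n)).ncard := by
  rw [Nat.one_le_iff_ne_zero, ← pos_iff_ne_zero, Set.ncard_pos (finite_bridgePairs g _)]
  have : ∀ n, IsBridge g (List.replicate n e) := by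
    intro n
    induction n with
    | zero => exact isBridge_nil g
    | succ n ih => exact (isBridge_singleton he).append ih
  exact ⟨(List.replicate n e, List.replicate n e), by simp; omega, rfl, this n, this n⟩

lemma ncard_words (d n : ℕ) : {w : List (Step d) | w.length = n}.ncard = (2 * d) ^ n := by
  have : {w : List (Step d) | w.length = n}.ncard = Fintype.card (List.Vector (Step d) n) := by
    rw [← Nat.card_eq_fintype_card]; rfl
  rw [this, card_vector, Fintype.card_prod, Fintype.card_fin, Fintype.card_bool, mul_comm]

lemma ncard_bridgePairs_le_pow (g : (Fin d → ℤ) →+ ℤ) (n : ℕ) :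
    (bridgePairs g n).ncard ≤ (n + 1) * (2 * d) ^ n := by
  have := Set.ncard_le_ncard_of_injOn (s := bridgePairs g n)
    (t := (↑(Finset.range (n + 1)) : Set ℕ) ×ˢ {w : List (Step d) | w.length = n})
    (fun p => (p.1.length, p.1 ++ p.2)) ?_ ?_
    ((Finset.finite_toSet _).prod (List.finite_length_eq _ _))
  · simpa only [Set.ncard_prod, ncard_range, ncard_words] using this
  · intro p hp
    have := hp.1
    simp only [Set.mem_prod, Finset.coe_range, Set.mem_Iio, Set.mem_ofPred_eq, List.length_append]
    omega
  · intro p hp q hq h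
    simp only [Prod.mk.injEq] at h
    obtain ⟨h1, h2⟩ := List.append_inj h.2 h.1
    exact Prod.ext h1 h2

end Counting

end ISAP

namespace ISAP

/-! ### Existence of the growth rate by subadditivity. -/

section Growth

/-- A supermultiplicative sequence with positive even terms and at most exponential growth has an
exponential growth rate, which also bounds every term. -/
lemma exists_growth_rate {s : ℕ → ℕ} {D : ℕ} (hD : 1 ≤ D)
    (hmul : ∀ n m, s n * s m ≤ s (n + m)) (hone : ∀ n, 1 ≤ s (2 * n))
    (hpow : ∀ n, s n ≤ (n + 1) * D ^ n) :
    ∃ μ : ℝ, 0 < μ ∧ (∀ n, (s n : ℝ) ≤ μ ^ n) ∧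
      Tendsto (fun k : ℕ => Real.log (s (2 * k)) / (2 * k : ℝ)) atTop (𝓝 (Real.log μ)) := by
  have hpos : ∀ k, (0 : ℝ) < s (2 * k) := fun k => by exact_mod_cast hone k
  have hD0 : (0 : ℝ) < D := by exact_mod_cast hD
  have hsub : Subadditive fun k : ℕ => -Real.log (s (2 * k)) := by
    intro m n
    have h : (s (2 * m) : ℝ) * s (2 * n) ≤ s (2 * (m + n)) := by
      rw [mul_add]; exact_mod_cast hmul _ _
    have := Real.log_le_log (mul_pos (hpos m) (hpos n)) h
    rw [Real.log_mul (hpos m).ne' (hpos n).ne'] at this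
    linarith
  have hbdd : BddBelow (Set.range fun n : ℕ => -Real.log (s (2 * n)) / n) := by
    refine ⟨-(2 + 2 * Real.log D), ?_⟩
    rintro _ ⟨k, rfl⟩
    have hlogD : 0 ≤ Real.log D := Real.log_nonneg (by exact_mod_cast hD)
    rcases Nat.eq_zero_or_pos k with rfl | hk
    · simp; linarith
    · have hk0 : (0 : ℝ) < k := by exact_mod_cast hk
      have h1 : (s (2 * k) : ℝ) ≤ (2 * k + 1) * (D : ℝ) ^ (2 * k) := by exact_mod_cast hpow (2 * k)
      have h2 := Real.log_le_log (hpos k) h1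
      rw [Real.log_mul (by positivity) (by positivity), Real.log_pow] at h2
      have h3 := Real.log_le_sub_one_of_pos (show (0 : ℝ) < 2 * k + 1 by positivity)
      push_cast at h2
      simp only
      rw [le_div_iff₀ hk0]
      nlinarith
  have hlim := hsub.tendsto_lim hbdd
  have hle : ∀ k, (s (2 * k) : ℝ) ≤ Real.exp (-hsub.lim / 2) ^ (2 * k) := by
    intro k
    rw [← Real.exp_nat_mul, ← Real.log_le_iff_le_exp (hpos k)]
    rcases Nat.eq_zero_or_pos k with rfl | hk
    · have h0 : s 0 * s 0 ≤ s 0 := hmul 0 0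
      have h1 : 1 ≤ s 0 := hone 0
      have : s 0 = 1 := by nlinarith
      simp [this]
    · have hk0 : (0 : ℝ) < k := by exact_mod_cast hk
      have := hsub.lim_le_div hbdd hk.ne'
      rw [le_div_iff₀ hk0] at this
      push_cast
      linarith
  refine ⟨Real.exp (-hsub.lim / 2), Real.exp_pos _, fun n => ?_, ?_⟩
  -- Fekete's lemma is applied to even indices only, where the terms are positive. The bound for
  -- every `n` follows from `s n ^ 2 ≤ s (2 * n)`.
  · refine le_of_sq_le_sq ?_ (by positivity)
    have h1 : (s n : ℝ) * s n ≤ s (2 * n) := by rw [two_mul]; exact_mod_cast hmul n n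
    calc (s n : ℝ) ^ 2 = s n * s n := sq _
      _ ≤ _ := h1.trans (hle n)
      _ = _ := by rw [mul_comm 2 n, pow_mul]
  · rw [Real.log_exp]
    refine (hlim.neg.div_const 2).congr fun k => ?_
    rcases Nat.eq_zero_or_pos k with rfl | hk
    · simp
    · have hk0 : (k : ℝ) ≠ 0 := by exact_mod_cast hk.ne'
      field_simp

lemma tendsto_log_div : Tendsto (fun k : ℕ => Real.log (2 * k + 1) / (2 * (k + 1) : ℝ))
    atTop (𝓝 0) := by
  have h1 : Tendsto (fun x : ℝ => Real.log x / x) atTop (𝓝 0) := by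
    simpa using Real.tendsto_pow_log_div_mul_add_atTop 1 0 1 one_ne_zero
  have h2 : Tendsto (fun k : ℕ => (2 * k + 1 : ℝ)) atTop atTop := by
    refine tendsto_atTop_add_const_right _ _ ?_
    exact tendsto_natCast_atTop_atTop.const_mul_atTop two_pos
  refine squeeze_zero (fun k => ?_) (fun k => ?_) (h1.comp h2)
  · exact div_nonneg (Real.log_nonneg (by linarith [Nat.cast_nonneg (α := ℝ) k])) (by positivity)
  · simp only [Function.comp_apply]
    have : 0 ≤ Real.log (2 * k + 1 : ℝ) :=
      Real.log_nonneg (by linarith [Nat.cast_nonneg (α := ℝ) k])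
    gcongr
    linarith

/-- A sequence that is comparable to `s`, up to polynomial factors and a shift by `2`, has the
same growth rate. -/
lemma tendsto_growth_rate {s G : ℕ → ℕ} {μ : ℝ} (hμ : 0 < μ) (hone : ∀ n, 1 ≤ s (2 * n))
    (hle : ∀ n, (s n : ℝ) ≤ μ ^ n)
    (hlim : Tendsto (fun k : ℕ => Real.log (s (2 * k)) / (2 * k : ℝ)) atTop (𝓝 (Real.log μ)))
    (h1 : ∀ n, 2 ≤ n → G n ≤ n * (n * s (n + 2)))
    (h2 : ∀ n, n ≠ 0 → s n ≤ (n + 1) * (n * (n * G (n + 2)))) :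
    Tendsto (fun k : ℕ => (G (2 * k) : ℝ) ^ (1 / ((2 * k : ℕ) : ℝ))) atTop (𝓝 μ) := by
  have hspos : ∀ k, (0 : ℝ) < s (2 * k) := fun k => by exact_mod_cast hone k
  have hGpos : ∀ k, k ≠ 0 → 0 < G (2 * (k + 1)) := by
    intro k hk
    have := (hone k).trans (h2 (2 * k) (by omega))
    rw [Nat.pos_iff_ne_zero]
    intro h0
    rw [mul_add, mul_one] at h0
    rw [h0] at this
    simp at this
  -- The lower bound controls `G (2 * k + 2)` by `s (2 * k)`, so the limit is taken at `k + 1`.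
  rw [← tendsto_add_atTop_iff_nat 1]
  have hlog : Tendsto (fun k : ℕ => Real.log (G (2 * (k + 1))) / (2 * (k + 1) : ℝ)) atTop
      (𝓝 (Real.log μ)) := by
    have hkk : Tendsto (fun k : ℕ => (k : ℝ) / (k + 1)) atTop (𝓝 1) :=
      tendsto_natCast_div_add_atTop 1
    have hinv : Tendsto (fun k : ℕ => 1 / ((k : ℝ) + 1)) atTop (𝓝 0) :=
      tendsto_one_div_add_atTop_nhds_zero_nat
    have hlow : Tendsto (fun k : ℕ => Real.log (s (2 * k)) / (2 * k : ℝ) * (k / (k + 1)) -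
        3 * (Real.log (2 * k + 1) / (2 * (k + 1) : ℝ))) atTop (𝓝 (Real.log μ)) := by
      simpa using (hlim.mul hkk).sub (tendsto_log_div.const_mul 3)
    have hup : Tendsto (fun k : ℕ => 2 * (Real.log (2 * k + 1) / (2 * (k + 1) : ℝ) +
        Real.log 2 / 2 * (1 / ((k : ℝ) + 1))) + (1 + 1 / ((k : ℝ) + 1)) * Real.log μ) atTop
        (𝓝 (Real.log μ)) := by
      have h3 := ((tendsto_log_div.add (hinv.const_mul (Real.log 2 / 2))).const_mul 2).add
        ((hinv.const_add 1).mul_const (Real.log μ))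
      simpa using h3
    refine tendsto_of_tendsto_of_tendsto_of_le_of_le' hlow hup ?_ ?_
    · filter_upwards [eventually_ne_atTop 0] with k hk
      have hk0 : (0 : ℝ) < k := by exact_mod_cast Nat.pos_of_ne_zero hk
      have hG : (0 : ℝ) < G (2 * (k + 1)) := by exact_mod_cast hGpos k hk
      have h3 : (s (2 * k) : ℝ) ≤ (2 * k + 1) ^ 3 * G (2 * (k + 1)) := by
        have h4 : (s (2 * k) : ℝ) ≤ (2 * k + 1) * (2 * k * (2 * k * G (2 * (k + 1)))) := by
          exact_mod_cast h2 (2 * k) (by omega)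
        refine h4.trans ?_
        have : (2 * k + 1 : ℝ) ^ 3 * G (2 * (k + 1)) =
          (2 * k + 1) * ((2 * k + 1) * ((2 * k + 1) * G (2 * (k + 1)))) := by ring
        rw [this]
        gcongr <;> linarith
      have h5 := Real.log_le_log (hspos k) h3
      rw [Real.log_mul (by positivity) hG.ne', Real.log_pow] at h5
      have h6 : Real.log (s (2 * k)) / (2 * k : ℝ) * (k / (k + 1)) =
          Real.log (s (2 * k)) / (2 * (k + 1)) := by
        field_simp
      rw [h6, ← mul_div_assoc, ← sub_div]
      gcongr
      push_cast at h5
      linarith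
    · filter_upwards [eventually_ne_atTop 0] with k hk
      have hk0 : (0 : ℝ) < k := by exact_mod_cast Nat.pos_of_ne_zero hk
      have hG : (0 : ℝ) < G (2 * (k + 1)) := by exact_mod_cast hGpos k hk
      have h3 : (G (2 * (k + 1)) : ℝ) ≤ (2 * (2 * k + 1)) ^ 2 * μ ^ (2 * k + 4) := by
        have h4 : (G (2 * (k + 1)) : ℝ) ≤
            (2 * (k + 1)) * ((2 * (k + 1)) * s (2 * (k + 1) + 2)) := by
          exact_mod_cast h1 (2 * (k + 1)) (by omega)
        refine h4.trans ?_
        have h7 := hle (2 * (k + 1) + 2)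
        have : (2 * (2 * k + 1 : ℝ)) ^ 2 * μ ^ (2 * k + 4) =
          (2 * (2 * k + 1)) * ((2 * (2 * k + 1)) * μ ^ (2 * (k + 1) + 2)) := by ring
        rw [this]
        gcongr <;> linarith
      have h5 := Real.log_le_log hG h3
      rw [Real.log_mul (by positivity) (by positivity), Real.log_pow, Real.log_pow,
        Real.log_mul (by positivity) (by positivity)] at h5
      rw [div_le_iff₀ (by positivity)]
      refine h5.trans (le_of_eq ?_)
      field_simp
      push_cast
      ring
  have hexp := (Real.continuous_exp.tendsto _).comp hlog
  rw [Real.exp_log hμ] at hexp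
  refine hexp.congr' ?_
  filter_upwards [eventually_ne_atTop 0] with k hk
  have hG : (0 : ℝ) < G (2 * (k + 1)) := by exact_mod_cast hGpos k hk
  rw [Real.rpow_def_of_pos hG]
  simp only [Function.comp_apply]
  push_cast
  rw [mul_one_div]

end Growth

/-! ### Periodic self-avoiding walks by Cauchy–Schwarz. -/

section Periodic

variable {d : ℕ}

/-- The words of length `n` with self-avoiding periodic repetition. -/
def periodicWords (d n : ℕ) : Set (List (Step d)) := {w | w.length = n ∧ SAW (w ++ w)}

lemma finite_periodicWords (n : ℕ) : (periodicWords d n).Finite :=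
  (List.finite_length_eq (Step d) n).subset fun _ hw => hw.1

/-- Sort the words by displacement, which lies in a box of `(2 * n + 1) ^ d` points. Two words in
the same class form a periodic pair, and Cauchy–Schwarz compares the squared sum of the class sizes
with the sum of their squares. -/
lemma ncard_periodicWords_sq_le {n : ℕ} (hn : n ≠ 0) :
    (periodicWords d n).ncard ^ 2 ≤ (2 * n + 1) ^ d * (periodicPairs d (2 * n)).ncard := by
  classical
  set Q := (finite_periodicWords (d := d) n).toFinset with hQ
  set P := (finite_periodicPairs (d := d) (2 * n)).toFinset with hP
  set B : Finset (Fin d → ℤ) := Fintype.piFinset fun _ => Finset.Icc (-(n : ℤ)) n with hB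
  have hcardB : B.card = (2 * n + 1) ^ d := by
    rw [hB, Fintype.card_piFinset]
    simp only [Int.card_Icc, Finset.prod_const, Finset.card_univ, Fintype.card_fin]
    congr 1
    omega
  have hQB : ∀ w ∈ Q, disp w ∈ B := by
    intro w hw
    have hl : w.length = n := ((Set.Finite.mem_toFinset _).mp hw).1
    rw [hB, Fintype.mem_piFinset]
    intro i
    have := abs_disp_le w i
    rw [hl, abs_le] at this
    exact Finset.mem_Icc.mpr this
  have hmemP : ∀ a b, a ∈ Q → b ∈ Q → disp a = disp b → (a, b) ∈ P := by
    intro a b ha hb hab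
    obtain ⟨ha1, ha2⟩ := (Set.Finite.mem_toFinset _).mp ha
    obtain ⟨hb1, hb2⟩ := (Set.Finite.mem_toFinset _).mp hb
    refine (Set.Finite.mem_toFinset _).mpr ⟨by simp only; omega, hab, ?_, ?_, ha2, hb2⟩
    · exact List.ne_nil_of_length_pos (by simp only; omega)
    · exact List.ne_nil_of_length_pos (by simp only; omega)
  have h1 : Q.card = ∑ y ∈ B, (Q.filter fun w => disp w = y).card :=
    Finset.card_eq_sum_card_fiberwise hQB
  have h2 : ∑ y ∈ B, (Q.filter fun w => disp w = y).card ^ 2 ≤ P.card := by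
    calc ∑ y ∈ B, (Q.filter fun w => disp w = y).card ^ 2
        ≤ ∑ y ∈ B, (P.filter fun p => disp p.1 = y).card := by
          refine Finset.sum_le_sum fun y _ => ?_
          rw [sq, ← Finset.card_product]
          refine Finset.card_le_card ?_
          rintro ⟨a, b⟩ hab
          simp only [Finset.mem_product, Finset.mem_filter] at hab ⊢
          exact ⟨hmemP a b hab.1.1 hab.2.1 (hab.1.2.trans hab.2.2.symm), hab.1.2⟩
      _ = (P.filter fun p => disp p.1 ∈ B).card := Finset.sum_card_fiberwise_eq_card_filter _ _ _
      _ ≤ P.card := Finset.card_filter_le _ _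
  rw [Set.ncard_eq_toFinset_card _ (finite_periodicWords n),
    Set.ncard_eq_toFinset_card _ (finite_periodicPairs (2 * n)), ← hQ, ← hP, h1, ← hcardB]
  exact sq_sum_le_card_mul_sum_sq.trans (Nat.mul_le_mul_left _ h2)

end Periodic

lemma real_sq_bound {d n : ℕ} {μ G : ℝ} (hμ : 0 < μ) (hn : 2 ≤ n)
    (hG0 : 0 ≤ G) (hG : G ≤ (2 * (2 * n + 2) + 2) ^ 2 * μ ^ (2 * n + 4)) :
    (2 * n + 1) ^ d * ((2 * n + 1) * (2 * n * (2 * n * G))) ≤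
      ((2 * n + 2 : ℝ) ^ (d + 10) * μ ^ (n + 2)) ^ 2 := by
  have hn' : (2 : ℝ) ≤ n := by exact_mod_cast hn
  -- Every polynomial factor is absorbed into a power of `x`; the exponent `d + 10` is generous.
  obtain ⟨x, hx⟩ : ∃ x : ℝ, x = 2 * n + 2 := ⟨_, rfl⟩
  have hx1 : 1 ≤ x := by linarith
  have hsq : 2 * x + 2 ≤ x ^ 2 := by nlinarith
  rw [← hx] at hG ⊢
  calc (2 * n + 1 : ℝ) ^ d * ((2 * n + 1) * (2 * n * (2 * n * G)))
      ≤ x ^ d * (x * (x * (x * ((x ^ 2) ^ 2 * μ ^ (2 * n + 4))))) := by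
        have h1 : (2 * n + 1 : ℝ) ≤ x := by linarith
        have h2 : (2 * n : ℝ) ≤ x := by linarith
        have h3 : G ≤ (x ^ 2) ^ 2 * μ ^ (2 * n + 4) := hG.trans (by gcongr)
        gcongr
    _ = x ^ (d + 7) * μ ^ (2 * n + 4) := by ring
    _ ≤ x ^ ((d + 10) * 2) * μ ^ (2 * n + 4) := by
        gcongr
        omega
    _ = _ := by ring

/-- The growth rate of the number of loops, and the matching upper bounds for loops and for
periodic self-avoiding walks. -/
theorem exists_loop_growth_rate {d : ℕ} (hd : 2 ≤ d) :
    ∃ μ : ℝ, 0 < μ ∧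
      Tendsto (fun k : ℕ => ((loopWords (AddMonoidHom.id (Fin d → ℤ)) (2 * k)).ncard : ℝ) ^
        (1 / ((2 * k : ℕ) : ℝ))) atTop (𝓝 μ) ∧
      (∀ n, 2 ≤ n → ((loopWords (AddMonoidHom.id (Fin d → ℤ)) n).ncard : ℝ) ≤
        (2 * n + 2) ^ (d + 10) * μ ^ (n + 2)) ∧
      (∀ n, 2 ≤ n → ((periodicWords d n).ncard : ℝ) ≤ (2 * n + 2) ^ (d + 10) * μ ^ (n + 2)) := by
  let i : Fin d := ⟨0, by omega⟩
  -- Any coordinate direction would do for the bridges.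
  let g : (Fin d → ℤ) →+ ℤ := Pi.evalAddMonoidHom (fun _ => ℤ) i
  let e : Step d := (i, true)
  have he : 0 < g (vec e) := by simp [g, e, vec]
  obtain ⟨s, hs⟩ : ∃ s : ℕ → ℕ, ∀ n, s n = (bridgePairs g n).ncard := ⟨_, fun _ => rfl⟩
  obtain ⟨G, hG⟩ : ∃ G : ℕ → ℕ, ∀ n, G n = (loopWords (AddMonoidHom.id (Fin d → ℤ)) n).ncard :=
    ⟨_, fun _ => rfl⟩
  have hone : ∀ n, 1 ≤ s (2 * n) := fun n => by
    rw [hs]; exact one_le_ncard_bridgePairs g he n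
  obtain ⟨μ, hμ, hle, hlim⟩ := exists_growth_rate (s := s) (D := 2 * d) (by omega)
    (fun n m => by simp only [hs]; exact ncard_bridgePairs_mul_le g n m) hone
    (fun n => by rw [hs]; exact ncard_bridgePairs_le_pow g n)
  have h1 : ∀ n, 2 ≤ n → G n ≤ n * (n * s (n + 2)) :=
    fun n hn => by rw [hG, hs]; exact ncard_loopWords_le g he hn
  have h2 : ∀ n, n ≠ 0 → s n ≤ (n + 1) * (n * (n * G (n + 2))) :=
    fun n hn => by rw [hG, hs]; exact ncard_bridgePairs_le hd g hn
  have hGle : ∀ n, 2 ≤ n → (G n : ℝ) ≤ (2 * n + 2) ^ 2 * μ ^ (n + 2) := by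
    intro n hn
    have h3 : (G n : ℝ) ≤ n * (n * s (n + 2)) := by exact_mod_cast h1 n hn
    refine h3.trans ?_
    have h4 : (n : ℝ) ≤ 2 * n + 2 := by linarith [Nat.cast_nonneg (α := ℝ) n]
    calc (n : ℝ) * (n * s (n + 2)) ≤ (2 * n + 2) * ((2 * n + 2) * μ ^ (n + 2)) := by
          have := hle (n + 2)
          gcongr
      _ = _ := by ring
  simp only [← hG]
  refine ⟨μ, hμ, tendsto_growth_rate hμ hone hle hlim h1 h2, fun n hn => ?_, fun n hn => ?_⟩
  · refine (hGle n hn).trans ?_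
    have : (1 : ℝ) ≤ 2 * n + 2 := by linarith [Nat.cast_nonneg (α := ℝ) n]
    gcongr
    omega
  · refine le_of_sq_le_sq ?_ (by positivity)
    have h3 := (ncard_periodicWords_sq_le (d := d) (n := n) (by omega)).trans
      (Nat.mul_le_mul_left _ (ncard_periodicPairs_le hd (2 * n)))
    rw [← hG] at h3
    have h4 : ((periodicWords d n).ncard : ℝ) ^ 2 ≤
        (2 * n + 1) ^ d * ((2 * n + 1) * (2 * n * (2 * n * G (2 * n + 2)))) := by
      exact_mod_cast h3
    refine h4.trans ?_
    have h5 := hGle (2 * n + 2) (by omega)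
    push_cast at h5
    exact real_sq_bound hμ hn (Nat.cast_nonneg _) h5

end ISAP

namespace ISAP

/-! ### Polygons as periodic vertex sequences. -/

section PolygonSequence

variable {V : Type} {G : SimpleGraph V}

/-- The vertices of a polygon can be enumerated periodically along its edges, starting anywhere. -/
lemma Polygon.exists_seq (γ : Polygon G) {x : V} (hx : x ∈ γ.verts) :
    ∃ v : ℕ → V, v 0 = x ∧ (∀ i j, v i = v j ↔ i ≡ j [MOD γ.verts.card]) ∧
      ∀ e, e ∈ γ.edges ↔ ∃ i, e = (v i, v (i + 1)) := by
  classical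
  have hout : ∀ a : γ.verts, ∃ b : γ.verts, (a.1, b.1) ∈ γ.edges := by
    rintro ⟨a, ha⟩
    obtain ⟨b, hb, _⟩ := γ.existsUnique_out a ha
    exact ⟨⟨b, γ.snd_mem _ hb⟩, hb⟩
  choose nxt hnxt using hout
  have hinj : Function.Injective nxt := by
    intro a b hab
    obtain ⟨c, _, hc⟩ := γ.existsUnique_in (nxt a) (nxt a).2
    have h1 := hc a.1 (hnxt a)
    have h2 := hc b.1 (by rw [hab]; exact hnxt b)
    exact Subtype.ext (h1.trans h2.symm)
  let σ : Equiv.Perm γ.verts := Equiv.ofBijective nxt (Finite.injective_iff_bijective.mp hinj)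
  have hedge : ∀ a b : V, (a, b) ∈ γ.edges →
      ∃ (ha : a ∈ γ.verts) (hb : b ∈ γ.verts), σ ⟨a, ha⟩ = ⟨b, hb⟩ := by
    intro a b hab
    have ha := γ.fst_mem _ hab
    refine ⟨ha, γ.snd_mem _ hab, Subtype.ext ?_⟩
    obtain ⟨c, _, hc⟩ := γ.existsUnique_out a ha
    exact (hc _ (hnxt ⟨a, ha⟩)).trans (hc _ hab).symm
  have hsame : ∀ a b : V, Relation.EqvGen (fun a b => (a, b) ∈ γ.edges) a b →
      a = b ∨ ∃ (ha : a ∈ γ.verts) (hb : b ∈ γ.verts), σ.SameCycle ⟨a, ha⟩ ⟨b, hb⟩ := by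
    intro a b h
    induction h with
    | rel a b h =>
      obtain ⟨ha, hb, h⟩ := hedge a b h
      exact Or.inr ⟨ha, hb, ⟨1, by simpa using h⟩⟩
    | refl a => exact Or.inl rfl
    | symm a b _ ih =>
      rcases ih with rfl | ⟨ha, hb, h⟩
      · exact Or.inl rfl
      · exact Or.inr ⟨hb, ha, h.symm⟩
    | trans a b c _ _ ih1 ih2 =>
      rcases ih1 with rfl | ⟨ha, hb, h⟩
      · exact ih2
      · rcases ih2 with rfl | ⟨hb', hc, h'⟩
        · exact Or.inr ⟨ha, hb, h⟩
        · exact Or.inr ⟨ha, hc, h.trans h'⟩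
  -- Unique in- and out-edges make the successor map a permutation; connectedness makes it a single
  -- cycle.
  have hcyc : σ.IsCycleOn (Finset.univ : Finset γ.verts) := by
    refine ⟨by simpa using σ.bijective.bijOn_univ, ?_⟩
    rintro ⟨a, ha⟩ _ ⟨b, hb⟩ _
    rcases hsame a b (γ.connected a ha b hb) with rfl | ⟨_, _, h⟩
    · exact Equiv.Perm.SameCycle.rfl
    · exact h
  have hcard : (Finset.univ : Finset γ.verts).card = γ.verts.card := by simp
  refine ⟨fun i => ((σ ^ i) ⟨x, hx⟩).1, rfl, fun i j => ?_, ?_⟩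
  · rw [← hcard, ← hcyc.pow_apply_eq_pow_apply (Finset.mem_univ ⟨x, hx⟩)]
    exact Subtype.ext_iff.symm
  · rintro ⟨a, b⟩
    constructor
    · intro h
      obtain ⟨ha, hb, hab⟩ := hedge a b h
      obtain ⟨i, _, hi⟩ := hcyc.exists_pow_eq (Finset.mem_univ ⟨x, hx⟩) (Finset.mem_univ ⟨a, ha⟩)
      refine ⟨i, ?_⟩
      beta_reduce
      rw [pow_succ', Equiv.Perm.mul_apply, hi, hab]
    · rintro ⟨i, hi⟩
      beta_reduce at hi
      rw [hi, pow_succ', Equiv.Perm.mul_apply]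
      exact hnxt _

/-- The polygon traced by a periodic sequence of vertices. -/
def polygonOfSeq [DecidableEq V] (n : ℕ) (v : ℕ → V) (hn : 0 < n)
    (hv : ∀ i j, v i = v j ↔ i ≡ j [MOD n]) (hadj : ∀ i, G.Adj (v i) (v (i + 1))) :
    Polygon G where
  verts := (Finset.range n).image v
  edges := (Finset.range n).image fun i => (v i, v (i + 1))
  adj_of_mem := by
    intro e he
    obtain ⟨i, _, rfl⟩ := Finset.mem_image.mp he
    exact hadj i
  fst_mem := by
    intro e he
    obtain ⟨i, hi, rfl⟩ := Finset.mem_image.mp he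
    exact Finset.mem_image_of_mem v hi
  snd_mem := by
    intro e he
    obtain ⟨i, hi, rfl⟩ := Finset.mem_image.mp he
    exact Finset.mem_image.mpr ⟨(i + 1) % n, Finset.mem_range.mpr (Nat.mod_lt _ hn),
      (hv _ _).mpr (Nat.mod_modEq _ _)⟩
  existsUnique_out := by
    intro x hx
    obtain ⟨i, hi, rfl⟩ := Finset.mem_image.mp hx
    refine ⟨v (i + 1), Finset.mem_image.mpr ⟨i, hi, rfl⟩, ?_⟩
    intro y hy
    obtain ⟨j, _, hj⟩ := Finset.mem_image.mp hy
    obtain ⟨h1, rfl⟩ := Prod.mk.inj hj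
    exact (hv _ _).mpr (((hv _ _).mp h1).add_right 1)
  existsUnique_in := by
    intro x hx
    obtain ⟨i, hi, rfl⟩ := Finset.mem_image.mp hx
    refine ⟨v (i + (n - 1)), Finset.mem_image.mpr ⟨(i + (n - 1)) % n,
      Finset.mem_range.mpr (Nat.mod_lt _ hn), ?_⟩, ?_⟩
    · refine Prod.ext ((hv _ _).mpr (Nat.mod_modEq _ _)) ((hv _ _).mpr ?_)
      have h1 : (i + (n - 1)) % n + 1 ≡ i + (n - 1) + 1 [MOD n] := (Nat.mod_modEq _ _).add_right 1
      have h2 : i + (n - 1) + 1 = i + n := by omega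
      rw [h2] at h1
      exact h1.trans (Nat.add_modEq_right)
    · intro y hy
      obtain ⟨j, _, hj⟩ := Finset.mem_image.mp hy
      obtain ⟨rfl, h1⟩ := Prod.mk.inj hj
      refine (hv _ _).mpr (Nat.ModEq.add_right_cancel' 1 (((hv _ _).mp h1).trans ?_))
      have h2 : i + (n - 1) + 1 = i + n := by omega
      rw [h2]
      exact (Nat.add_modEq_right).symm
  connected := by
    have hall : ∀ i < n, Relation.EqvGen
        (fun a b => (a, b) ∈ (Finset.range n).image fun i => (v i, v (i + 1))) (v 0) (v i) := by
      intro i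
      induction i with
      | zero => exact fun _ => Relation.EqvGen.refl _
      | succ i ih =>
        intro hi
        exact (ih (by omega)).trans _ _ _ (Relation.EqvGen.rel _ _
          (Finset.mem_image.mpr ⟨i, Finset.mem_range.mpr (by omega), rfl⟩))
    intro x hx y hy
    obtain ⟨i, hi, rfl⟩ := Finset.mem_image.mp hx
    obtain ⟨j, hj, rfl⟩ := Finset.mem_image.mp hy
    exact ((hall i (Finset.mem_range.mp hi)).symm _ _).trans _ _ _ (hall j (Finset.mem_range.mp hj))

lemma Polygon.mem_verts_iff (γ : Polygon G) (x : V) : x ∈ γ.verts ↔ ∃ y, (x, y) ∈ γ.edges :=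
  ⟨fun h => (γ.existsUnique_out x h).exists, fun ⟨_, h⟩ => γ.fst_mem _ h⟩

lemma Polygon.ext_edges {γ γ' : Polygon G} (h : γ.edges = γ'.edges) : γ = γ' := by
  refine Polygon.ext (Finset.ext fun x => ?_) h
  rw [γ.mem_verts_iff, γ'.mem_verts_iff, h]

lemma Polygon.length_eq_card (γ : Polygon G) : γ.length = γ.verts.card := by
  classical
  rw [Polygon.length]
  refine Finset.card_nbij Prod.fst (fun e he => γ.fst_mem e he) ?_ ?_
  · rintro ⟨a, b⟩ h ⟨a', b'⟩ h' (rfl : a = a')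
    exact Prod.ext rfl ((γ.existsUnique_out a (γ.fst_mem _ h)).unique h h')
  · intro x hx
    obtain ⟨y, hy⟩ := (γ.mem_verts_iff x).mp hx
    exact ⟨(x, y), hy, rfl⟩

end PolygonSequence

/-! ### Polygons through the origin as loop words. -/

section PolygonWord

variable {d : ℕ} {R : Type} [Ring R]

/-- The reduction of integer vectors to vectors over `R`. -/
def castVec (d : ℕ) (R : Type) [Ring R] : (Fin d → ℤ) →+ (Fin d → R) :=
  (Int.castAddHom R).compLeft (Fin d)

@[simp] lemma castVec_apply (x : Fin d → ℤ) (i : Fin d) : castVec d R x i = (x i : R) := rfl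

lemma castVec_int (d : ℕ) : castVec d ℤ = AddMonoidHom.id _ := by
  ext; simp

lemma castVec_single (i : Fin d) : castVec d R (Pi.single i 1) = Pi.single i 1 := by
  ext j
  by_cases h : j = i
  · subst h; simp
  · simp [h]

lemma latticeGraph_adj_iff {x y : Fin d → R} : (latticeGraph d R).Adj x y ↔
    x ≠ y ∧ ∃ s : Step d, y = x + castVec d R (vec s) := by
  rw [latticeGraph, SimpleGraph.fromRel_adj]
  refine and_congr_right fun _ => ⟨?_, ?_⟩
  · rintro (⟨i, rfl⟩ | ⟨i, rfl⟩)
    · exact ⟨(i, true), by simp [vec, castVec_single]⟩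
    · exact ⟨(i, false), by simp [vec, castVec_single]⟩
  · rintro ⟨⟨i, b⟩, rfl⟩
    cases b
    · exact Or.inr ⟨i, by simp [vec, castVec_single]⟩
    · exact Or.inl ⟨i, by simp [vec, castVec_single]⟩

/-- The word `w` describes the polygon `γ` through the origin. -/
def Traces (w : List (Step d)) (γ : Polygon (latticeGraph d R)) : Prop :=
  w.length = γ.verts.card ∧ ∀ e, e ∈ γ.edges ↔
    ∃ i < w.length, e = (castVec d R (disp (w.take i)), castVec d R (disp (w.take (i + 1))))

lemma Traces.polygon_unique {w : List (Step d)} {γ γ' : Polygon (latticeGraph d R)}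
    (h : Traces w γ) (h' : Traces w γ') : γ = γ' :=
  Polygon.ext_edges (Finset.ext fun e => by rw [h.2, h'.2])

lemma Traces.origin_mem {w : List (Step d)} {γ : Polygon (latticeGraph d R)} (hw : w ≠ [])
    (h : Traces w γ) : 0 ∈ γ.verts := by
  have := (h.2 _).mpr ⟨0, List.length_pos_iff.mpr hw, rfl⟩
  simpa using γ.fst_mem _ this

/-- Orientation leaves one way to leave each vertex, so the word is read off edge by edge.
Injectivity is needed because on a torus of side at most two opposite steps coincide. -/
lemma Traces.word_unique {w w' : List (Step d)} {γ : Polygon (latticeGraph d R)}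
    (hinj : Function.Injective fun s : Step d => castVec d R (vec s))
    (h : Traces w γ) (h' : Traces w' γ) : w = w' := by
  have hlen : w.length = w'.length := h.1.trans h'.1.symm
  have key : ∀ i ≤ w.length, w.take i = w'.take i := by
    intro i
    induction i with
    | zero => simp
    | succ i ih =>
      intro hi
      have ih := ih (by omega)
      have h1 := (h.2 _).mpr ⟨i, by omega, rfl⟩
      have h2 := (h'.2 _).mpr ⟨i, by omega, rfl⟩
      rw [← ih] at h2
      have h3 := (γ.existsUnique_out _ (γ.fst_mem _ h1)).unique h1 h2
      have e1 : w.take (i + 1) = w.take i ++ [w[i]] := by simp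
      have e2 : w'.take (i + 1) = w.take i ++ [w'[i]] := by simp [ih]
      rw [e1, e2, disp_append, disp_append, map_add, map_add] at h3
      have h4 := hinj (by simpa using add_left_cancel h3 : castVec d R (vec w[i]) = _)
      rw [e1, e2, h4]
  have := key w.length le_rfl
  rwa [List.take_length, hlen, List.take_length] at this

lemma exists_traces (γ : Polygon (latticeGraph d R)) (h0 : 0 ∈ γ.verts) :
    ∃ w, Traces w γ ∧ IsLoop (castVec d R) w := by
  obtain ⟨v, hv0, hv, hedge⟩ := γ.exists_seq h0
  set n := γ.verts.card with hn
  have hstep : ∀ i, ∃ s : Step d, v (i + 1) = v i + castVec d R (vec s) := fun i =>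
    (latticeGraph_adj_iff.mp (γ.adj_of_mem _ ((hedge _).mpr ⟨i, rfl⟩))).2
  choose s hs using hstep
  have hvs : ∀ i, castVec d R (disp ((List.range i).map s)) = v i := by
    intro i
    induction i with
    | zero => simp [hv0]
    | succ i ih => rw [List.range_succ, List.map_append, disp_append, map_add, ih, hs]; simp
  set w := (List.range n).map s with hw
  have hlen : w.length = n := by simp [hw]
  have htake : ∀ i ≤ n, w.take i = (List.range i).map s := by
    intro i hi
    rw [hw, ← List.map_take, List.take_range, min_eq_left hi]
  have hpre : ∀ p, p <+: w → castVec d R (disp p) = v p.length := by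
    intro p hp
    rw [List.prefix_iff_eq_take.mp hp, htake _ (hlen ▸ hp.length_le), hvs]
    simp
  refine ⟨w, ⟨hlen, fun e => ?_⟩, ?_, ?_⟩
  · rw [hedge, hlen]
    constructor
    · rintro ⟨i, rfl⟩
      have hnpos : 0 < n := Finset.card_pos.mpr ⟨0, h0⟩
      have hlt := Nat.mod_lt i hnpos
      refine ⟨i % n, hlt, ?_⟩
      rw [htake _ hlt.le, htake _ hlt, hvs, hvs]
      refine Prod.ext ((hv _ _).mpr (Nat.mod_modEq _ _).symm) ((hv _ _).mpr ?_)
      exact (Nat.mod_modEq _ _).symm.add_right 1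
    · rintro ⟨i, hi, rfl⟩
      exact ⟨i, by rw [htake _ hi.le, htake _ hi, hvs, hvs]⟩
  · rw [hw, hvs, ← hv0, hv]
    simp [Nat.ModEq]
  · rintro u ⟨p, q, hpq⟩ hne hul h
    have h1 := hpre (p ++ u) ⟨q, hpq⟩
    have h2 := hpre p ⟨u ++ q, by rw [← hpq, List.append_assoc]⟩
    rw [disp_append, map_add, h, add_zero, h2, hv, List.length_append] at h1
    have h3 : 0 ≡ u.length [MOD n] := Nat.ModEq.add_left_cancel' p.length h1
    have h4 : n ∣ u.length := (Nat.modEq_zero_iff_dvd).mp h3.symm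
    have h5 := Nat.le_of_dvd (List.length_pos_iff.mpr hne) h4
    omega

lemma IsLoop.disp_take_ne {w : List (Step d)} (hw : IsLoop (castVec d R) w) {i j : ℕ}
    (hij : i < j) (hj : j < w.length) :
    castVec d R (disp (w.take i)) ≠ castVec d R (disp (w.take j)) := by
  intro h
  have h1 : w.take i ++ (w.take j).drop i = w.take j := by
    conv_rhs => rw [← List.take_append_drop i (w.take j)]
    rw [List.take_take, min_eq_left hij.le]
  refine hw.2 ((w.take j).drop i) ?_ ?_ ?_ ?_
  · exact (List.drop_suffix _ _).isInfix.trans (List.take_prefix _ _).isInfix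
  · rw [Ne, List.drop_eq_nil_iff, List.length_take]
    omega
  · rw [List.length_drop, List.length_take]
    omega
  · rw [← h1, disp_append, map_add] at h
    simpa using h

/-- Prefix displacements, extended periodically, visit distinct vertices within a period. Length two
is allowed and gives a back-and-forth edge; length one would be a self-loop. -/
lemma exists_polygon_of_isLoop {w : List (Step d)} (hw : IsLoop (castVec d R) w)
    (hlen : 2 ≤ w.length) : ∃ γ : Polygon (latticeGraph d R), Traces w γ := by
  classical
  set n := w.length with hn
  have hnpos : 0 < n := by omega
  let v : ℕ → Fin d → R := fun i => castVec d R (disp (w.take (i % n)))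
  have hv : ∀ i j, v i = v j ↔ i ≡ j [MOD n] := by
    intro i j
    refine ⟨fun h => ?_, fun h => by simp only [v]; rw [h]⟩
    rcases lt_trichotomy (i % n) (j % n) with hlt | heq | hlt
    · exact absurd h (hw.disp_take_ne hlt (Nat.mod_lt _ hnpos))
    · exact heq
    · exact absurd h.symm (hw.disp_take_ne hlt (Nat.mod_lt _ hnpos))
  have hvlt : ∀ i < n, v i = castVec d R (disp (w.take i)) := fun i hi => by
    simp only [v, Nat.mod_eq_of_lt hi]
  have hvle : ∀ i ≤ n, v i = castVec d R (disp (w.take i)) := by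
    intro i hi
    rcases hi.lt_or_eq with h | rfl
    · exact hvlt i h
    · simp only [v, Nat.mod_self, List.take_zero, disp_nil, map_zero, hn, List.take_length]
      exact hw.1.symm
  have hadj : ∀ i, (latticeGraph d R).Adj (v i) (v (i + 1)) := by
    intro i
    rw [latticeGraph_adj_iff]
    constructor
    · rw [Ne, hv]
      intro h
      have : 0 ≡ 1 [MOD n] := Nat.ModEq.add_left_cancel' i h
      rw [Nat.ModEq, Nat.mod_eq_of_lt hnpos, Nat.mod_eq_of_lt (by omega)] at this
      omega
    · have hlt := Nat.mod_lt i hnpos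
      refine ⟨w[i % n], ?_⟩
      have h1 : v (i + 1) = v (i % n + 1) := (hv _ _).mpr ((Nat.mod_modEq _ _).symm.add_right 1)
      have h2 : v i = v (i % n) := (hv _ _).mpr (Nat.mod_modEq _ _).symm
      have e1 : w.take (i % n + 1) = w.take (i % n) ++ [w[i % n]] := by simp
      rw [h1, h2, hvle _ hlt, hvle _ hlt.le, e1, disp_append, map_add]
      simp
  refine ⟨polygonOfSeq n v hnpos hv hadj, ?_, fun e => ?_⟩
  · rw [polygonOfSeq, Finset.card_image_of_injOn, Finset.card_range]
    intro i hi j hj hij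
    have := (hv i j).mp hij
    rwa [Nat.ModEq, Nat.mod_eq_of_lt (by simpa using hi), Nat.mod_eq_of_lt (by simpa using hj)]
      at this
  · rw [polygonOfSeq, Finset.mem_image]
    constructor
    · rintro ⟨i, hi, rfl⟩
      have hi := Finset.mem_range.mp hi
      exact ⟨i, hi, by rw [hvle i hi.le, hvle _ hi]⟩
    · rintro ⟨i, hi, rfl⟩
      exact ⟨i, Finset.mem_range.mpr hi, by rw [hvle i hi.le, hvle _ hi]⟩

end PolygonWord

end ISAP

namespace ISAP

/-! ### Counting polygons on the lattice and on tori. -/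

section PolygonCount

variable {d : ℕ}

/-- The polygons over `R` through the origin that cover `n` vertices. -/
def polygonsAtZero (d : ℕ) (R : Type) [Ring R] (n : ℕ) : Set (Polygon (latticeGraph d R)) :=
  {γ | (0 : Fin d → R) ∈ γ.verts ∧ γ.verts.card = n}

lemma ncard_polygonsAtZero_le (R : Type) [Ring R] (n : ℕ) :
    (polygonsAtZero d R n).ncard ≤ (loopWords (castVec d R) n).ncard := by
  have key : ∀ γ : Polygon (latticeGraph d R), ∃ w, γ ∈ polygonsAtZero d R n →
      Traces w γ ∧ IsLoop (castVec d R) w := by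
    intro γ
    by_cases h : γ ∈ polygonsAtZero d R n
    · obtain ⟨w, hw⟩ := exists_traces γ h.1
      exact ⟨w, fun _ => hw⟩
    · exact ⟨[], fun h' => absurd h' h⟩
  choose F hF using key
  refine Set.ncard_le_ncard_of_injOn F ?_ ?_ (finite_loopWords _ _)
  · exact fun γ hγ => ⟨(hF γ hγ).1.1.trans hγ.2, (hF γ hγ).2⟩
  · intro γ hγ γ' hγ' h
    have h1 := (hF γ hγ).1
    rw [h] at h1
    exact h1.polygon_unique (hF γ' hγ').1

lemma finite_polygonsAtZero (R : Type) [Ring R] (n : ℕ) : (polygonsAtZero d R n).Finite := by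
  have key : ∀ γ : Polygon (latticeGraph d R), ∃ w, γ ∈ polygonsAtZero d R n →
      Traces w γ ∧ IsLoop (castVec d R) w := by
    intro γ
    by_cases h : γ ∈ polygonsAtZero d R n
    · obtain ⟨w, hw⟩ := exists_traces γ h.1
      exact ⟨w, fun _ => hw⟩
    · exact ⟨[], fun h' => absurd h' h⟩
  choose F hF using key
  refine Set.Finite.of_injOn (f := F) (t := loopWords (castVec d R) n) ?_ ?_ (finite_loopWords _ _)
  · exact fun γ hγ => ⟨(hF γ hγ).1.1.trans hγ.2, (hF γ hγ).2⟩
  · intro γ hγ γ' hγ' h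
    have h1 := (hF γ hγ).1
    rw [h] at h1
    exact h1.polygon_unique (hF γ' hγ').1

lemma le_ncard_polygonsAtZero (R : Type) [Ring R]
    (hinj : Function.Injective fun s : Step d => castVec d R (vec s)) {n : ℕ} (hn : 2 ≤ n) :
    (loopWords (castVec d R) n).ncard ≤ (polygonsAtZero d R n).ncard := by
  have key : ∀ w : List (Step d), ∃ γ : Polygon (latticeGraph d R),
      w ∈ loopWords (castVec d R) n → Traces w γ := by
    intro w
    by_cases h : w ∈ loopWords (castVec d R) n
    · obtain ⟨γ, hγ⟩ := exists_polygon_of_isLoop h.2 (by rw [h.1]; exact hn)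
      exact ⟨γ, fun _ => hγ⟩
    · exact ⟨⟨∅, ∅, by simp, by simp, by simp, by simp, by simp, by simp⟩, fun h' => absurd h' h⟩
  choose F hF using key
  refine Set.ncard_le_ncard_of_injOn F ?_ ?_ (finite_polygonsAtZero _ _)
  · intro w hw
    have hne : w ≠ [] := List.ne_nil_of_length_pos (by rw [hw.1]; omega)
    exact ⟨(hF w hw).origin_mem hne, (hF w hw).1.symm.trans hw.1⟩
  · intro w hw w' hw' h
    have h1 := hF w hw
    rw [h] at h1
    exact h1.word_unique hinj (hF w' hw')

lemma ncard_originPolygons {n : ℕ} (hn : 2 ≤ n) :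
    (originPolygons d n).ncard = (loopWords (AddMonoidHom.id (Fin d → ℤ)) n).ncard := by
  rw [← castVec_int]
  refine le_antisymm (ncard_polygonsAtZero_le ℤ n) (le_ncard_polygonsAtZero ℤ ?_ hn)
  rw [castVec_int]
  exact vec_injective

/-- A loop on a torus lifts either to a loop or to a walk with self-avoiding periodic
repetition. -/
lemma IsLoop.lift {M : Type*} [AddCommGroup M] {f : (Fin d → ℤ) →+ M} {w : List (Step d)}
    (h : IsLoop f w) : IsLoop (AddMonoidHom.id _) w ∨ SAW (w ++ w) := by
  by_cases h0 : disp w = 0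
  · refine Or.inl ⟨h0, fun u hu hne hl hu0 => h.2 u hu hne hl ?_⟩
    rw [AddMonoidHom.id_apply] at hu0
    rw [hu0, map_zero]
  · refine Or.inr fun u hu hne hu0 => ?_
    have hin : ∀ v, v <:+: w → f (disp v) = 0 → v = [] ∨ v.length = w.length := by
      intro v hv hv0
      by_contra! hcon
      exact h.2 v hv hcon.1 (lt_of_le_of_ne hv.length_le hcon.2) hv0
    have hself : ∀ v, v <:+: w → v ≠ [] → disp v ≠ 0 := by
      intro v hv hvne hv0
      rcases hin v hv (by rw [hv0, map_zero]) with h1 | h1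
      · exact hvne h1
      · exact h0 (by rw [← hv.eq_of_length h1, hv0])
    rcases List.infix_append_iff.mp hu with hu | hu | ⟨s, t, rfl, ⟨q, hq⟩, ⟨p, hp⟩⟩
    · exact hself u hu hne hu0
    · exact hself u hu hne hu0
    · have hfw := h.1
      -- A closed factor `s ++ t` across the seam has `s` and `t` either overlapping in `a` or
      -- separated by `b`. Then `disp a = -disp w` or `disp b = disp w`, so `a` or `b` is closed
      -- under `f` and must be empty or all of `w`. Each option contradicts `disp w ≠ 0` or `u ≠
      -- []`.
      rcases List.append_eq_append_iff.mp (hq.trans hp.symm) with ⟨a, rfl, rfl⟩ | ⟨b, rfl, rfl⟩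
      · have hw : disp w = disp q + disp a + disp p := by rw [← hp]; simp [add_assoc]
        have hsum : disp w + disp a = 0 := by
          rw [hw, ← hu0]; simp only [disp_append]; abel
        have hfa : f (disp a) = 0 := by
          have := congrArg f hsum
          rwa [map_add, hfw, zero_add, map_zero] at this
        rcases hin a ⟨q, p, hp⟩ hfa with rfl | hl
        · simp only [disp_nil, add_zero] at hsum
          exact h0 hsum
        · rw [List.IsInfix.eq_of_length ⟨q, p, hp⟩ hl] at hsum
          refine h0 (funext fun i => ?_)
          have := congrFun hsum i
          simp only [Pi.add_apply, Pi.zero_apply] at this ⊢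
          omega
      · have hw : disp w = disp t + disp b + disp s := by rw [← hq]; simp [add_assoc]
        have hsum : disp w = disp b := by
          rw [disp_append] at hu0
          calc disp w = disp b + (disp s + disp t) := by rw [hw]; abel
            _ = disp b := by rw [hu0, add_zero]
        rcases hin b ⟨t, s, hq⟩ (by rw [← hsum, hfw]) with rfl | hl
        · exact h0 hsum
        · refine hne ?_
          rw [← hq] at hl
          simp only [List.length_append] at hl
          rw [← List.length_eq_zero_iff, List.length_append]
          omega

lemma ncard_polygonsAtZero_le_add (R : Type) [Ring R] (n : ℕ) :
    (polygonsAtZero d R n).ncard ≤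
      (loopWords (AddMonoidHom.id (Fin d → ℤ)) n).ncard + (periodicWords d n).ncard := by
  refine (ncard_polygonsAtZero_le R n).trans ((Set.ncard_le_ncard ?_
    ((finite_loopWords _ _).union (finite_periodicWords _))).trans (Set.ncard_union_le _ _))
  rintro w ⟨hl, hw⟩
  exact hw.lift.imp (fun h => ⟨hl, h⟩) fun h => ⟨hl, h⟩

lemma eq_zero_of_castVec_eq_zero {L : ℕ} {x : Fin d → ℤ} (hx : castVec d (ZMod L) x = 0)
    (hlt : ∀ i, |x i| < L) : x = 0 := by
  funext i
  have h1 : ((x i : ℤ) : ZMod L) = 0 := congrFun hx i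
  exact Int.eq_zero_of_abs_lt_dvd ((ZMod.intCast_zmod_eq_zero_iff_dvd _ _).mp h1) (hlt i)

lemma castVec_vec_injective {L : ℕ} (hL : 3 ≤ L) :
    Function.Injective fun s : Step d => castVec d (ZMod L) (vec s) := by
  intro s t h
  refine vec_injective (sub_eq_zero.mp (eq_zero_of_castVec_eq_zero (L := L) ?_ fun i => ?_))
  · rw [map_sub, sub_eq_zero]; exact h
  · have h1 := abs_vec_le s i
    have h2 := abs_vec_le t i
    rw [Pi.sub_apply]
    have := abs_sub (vec s i) (vec t i)
    omega

/-- Short loops survive on the torus. -/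
lemma le_ncard_polygonsAtZero_torus {L n : ℕ} (hL : 3 ≤ L) (hn : 2 ≤ n) (hnL : n ≤ L) :
    (loopWords (AddMonoidHom.id (Fin d → ℤ)) n).ncard ≤ (polygonsAtZero d (ZMod L) n).ncard := by
  refine (Set.ncard_le_ncard ?_ (finite_loopWords _ _)).trans
    (le_ncard_polygonsAtZero (ZMod L) (castVec_vec_injective hL) hn)
  rintro w ⟨hl, h0, hw⟩
  refine ⟨hl, ?_, fun u hu hne hlt hu0 => hw u hu hne hlt ?_⟩
  · rw [AddMonoidHom.id_apply] at h0
    rw [h0, map_zero]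
  · refine eq_zero_of_castVec_eq_zero hu0 fun i => ?_
    have := abs_disp_le u i
    rw [AddMonoidHom.id_apply]
    omega

end PolygonCount

end ISAP

namespace ISAP

/-! ### Translation of polygons and configurations. -/

section Translation

variable {V : Type} {G : SimpleGraph V}

/-- The image of a polygon under an automorphism of the graph. -/
def Polygon.map (γ : Polygon G) (e : V ≃ V) (he : ∀ x y, G.Adj x y → G.Adj (e x) (e y)) :
    Polygon G where
  verts := γ.verts.map e.toEmbedding
  edges := γ.edges.map (e.prodCongr e).toEmbedding
  adj_of_mem := by
    intro p hp
    obtain ⟨q, hq, rfl⟩ := Finset.mem_map.mp hp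
    exact he _ _ (γ.adj_of_mem q hq)
  fst_mem := by
    intro p hp
    obtain ⟨q, hq, rfl⟩ := Finset.mem_map.mp hp
    exact Finset.mem_map_of_mem _ (γ.fst_mem q hq)
  snd_mem := by
    intro p hp
    obtain ⟨q, hq, rfl⟩ := Finset.mem_map.mp hp
    exact Finset.mem_map_of_mem _ (γ.snd_mem q hq)
  existsUnique_out := by
    intro x hx
    obtain ⟨v, hv, rfl⟩ := Finset.mem_map.mp hx
    obtain ⟨w, hw, hu⟩ := γ.existsUnique_out v hv
    refine ⟨e w, Finset.mem_map.mpr ⟨(v, w), hw, rfl⟩, fun y hy => ?_⟩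
    obtain ⟨⟨a, b⟩, hq, h⟩ := Finset.mem_map.mp hy
    obtain ⟨h1, rfl⟩ := Prod.mk.inj h
    rw [e.injective h1] at hq
    exact congrArg e (hu b hq)
  existsUnique_in := by
    intro x hx
    obtain ⟨v, hv, rfl⟩ := Finset.mem_map.mp hx
    obtain ⟨w, hw, hu⟩ := γ.existsUnique_in v hv
    refine ⟨e w, Finset.mem_map.mpr ⟨(w, v), hw, rfl⟩, fun y hy => ?_⟩
    obtain ⟨⟨a, b⟩, hq, h⟩ := Finset.mem_map.mp hy
    obtain ⟨rfl, h1⟩ := Prod.mk.inj h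
    rw [e.injective h1] at hq
    exact congrArg e (hu a hq)
  connected := by
    intro x hx y hy
    obtain ⟨v, hv, rfl⟩ := Finset.mem_map.mp hx
    obtain ⟨w, hw, rfl⟩ := Finset.mem_map.mp hy
    have := γ.connected v hv w hw
    clear hx hy hv hw
    induction this with
    | rel a b h => exact Relation.EqvGen.rel _ _ (Finset.mem_map.mpr ⟨(a, b), h, rfl⟩)
    | refl a => exact Relation.EqvGen.refl _
    | symm a b _ ih => exact ih.symm
    | trans a b c _ _ ih1 ih2 => exact ih1.trans _ _ _ ih2

@[simp] lemma Polygon.length_map (γ : Polygon G) (e : V ≃ V)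
    (he : ∀ x y, G.Adj x y → G.Adj (e x) (e y)) : (γ.map e he).length = γ.length :=
  Finset.card_map _

variable {d : ℕ} {R : Type} [Ring R]

lemma latticeGraph_adj_add (a x y : Fin d → R) (h : (latticeGraph d R).Adj x y) :
    (latticeGraph d R).Adj (Equiv.addRight a x) (Equiv.addRight a y) := by
  rw [latticeGraph_adj_iff] at h ⊢
  obtain ⟨hne, s, rfl⟩ := h
  refine ⟨fun h => hne ((Equiv.addRight a).injective h), s, ?_⟩
  simp only [Equiv.coe_addRight]
  abel

/-- The translate of a polygon. -/
def Polygon.translate (a : Fin d → R) (γ : Polygon (latticeGraph d R)) :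
    Polygon (latticeGraph d R) :=
  γ.map (Equiv.addRight a) (latticeGraph_adj_add a)

@[simp] lemma Polygon.length_translate (a : Fin d → R) (γ : Polygon (latticeGraph d R)) :
    (γ.translate a).length = γ.length := γ.length_map _ _

@[simp] lemma Polygon.add_mem_translate (a x : Fin d → R) (γ : Polygon (latticeGraph d R)) :
    x + a ∈ (γ.translate a).verts ↔ x ∈ γ.verts :=
  Finset.mem_map' (Equiv.addRight a).toEmbedding

lemma Polygon.translate_verts_eq_empty (a : Fin d → R) (γ : Polygon (latticeGraph d R)) :
    (γ.translate a).verts = ∅ ↔ γ.verts = ∅ :=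
  Finset.map_eq_empty

lemma Polygon.translate_translate (a b : Fin d → R) (γ : Polygon (latticeGraph d R))
    (h : a + b = 0) : (γ.translate a).translate b = γ := by
  have hab : ∀ x : Fin d → R, x + a + b = x := fun x => by rw [add_assoc, h, add_zero]
  refine Polygon.ext_edges (Finset.ext fun e => ?_)
  simp only [Polygon.translate, Polygon.map, Finset.mem_map]
  constructor
  · rintro ⟨_, ⟨⟨x, y⟩, hq, rfl⟩, rfl⟩
    simpa [hab] using hq
  · rintro he
    exact ⟨_, ⟨e, he, rfl⟩, Prod.ext (hab e.1) (hab e.2)⟩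

/-- Translation as a bijection. -/
def translateEquiv (a : Fin d → R) :
    Polygon (latticeGraph d R) ≃ Polygon (latticeGraph d R) where
  toFun := Polygon.translate a
  invFun := Polygon.translate (-a)
  left_inv γ := γ.translate_translate a (-a) (by simp)
  right_inv γ := γ.translate_translate (-a) a (by simp)

variable {L : ℕ}

/-- Translation from the polygons at `x` to the polygons at `x + a`. -/
def translateAt (a x : Torus d L) : PolygonAt d L x ≃ PolygonAt d L (x + a) :=
  (translateEquiv a).subtypeEquiv fun γ => by
    change _ ↔ (γ.translate a).verts = ∅ ∨ x + a ∈ (γ.translate a).verts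
    rw [Polygon.translate_verts_eq_empty, Polygon.add_mem_translate]

lemma translateAt_coe (a x : Torus d L) (γ : PolygonAt d L x) :
    (translateAt a x γ).1 = γ.1.translate a := rfl

/-- Translation of configurations. -/
def shiftConfig (a : Torus d L) : Config d L ≃ Config d L :=
  Equiv.piCongr (Equiv.addRight a) (translateAt a)

lemma shiftConfig_apply (a x : Torus d L) (γ : Config d L) :
    (shiftConfig a γ (x + a)).1 = (γ x).1.translate a := by
  have : shiftConfig a γ (Equiv.addRight a x) = translateAt a x (γ x) :=
    Equiv.piCongr_apply_apply _ _ _ _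
  rw [← translateAt_coe, ← this]
  rfl

end Translation

/-! ### Comparison of the model with independent polygons. -/

noncomputable section Model

variable {d L : ℕ} [NeZero L]

lemma sum_add_right (a : Torus d L) (F : Torus d L → ℝ) : ∑ x, F (x + a) = ∑ x, F x :=
  Equiv.sum_comp (Equiv.addRight a) F

lemma cumulativeLength_shift (a : Torus d L) (γ : Config d L) :
    cumulativeLength (shiftConfig a γ) = cumulativeLength γ := by
  rw [cumulativeLength, ← sum_add_right a, cumulativeLength]
  simp only [shiftConfig_apply, Polygon.length_translate]

lemma overlap_shift (a : Torus d L) (γ : Config d L) :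
    overlap (shiftConfig a γ) = overlap γ := by
  classical
  rw [overlap, ← sum_add_right a, overlap]
  refine Finset.sum_congr rfl fun x _ => ?_
  rw [← sum_add_right a]
  simp only [shiftConfig_apply, Polygon.add_mem_translate]

lemma energy_shift (α lam : ℝ) (a : Torus d L) (γ : Config d L) :
    energy α lam (shiftConfig a γ) = energy α lam γ := by
  rw [energy, energy, cumulativeLength_shift, overlap_shift, Finset.sum_filter,
    ← sum_add_right a, Finset.sum_filter]
  simp only [shiftConfig_apply, Polygon.length_translate]

/-- Shifting by `x` is an energy-preserving bijection that carries the polygon at the origin to the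
one at `x`. -/
lemma sum_prob_length (α lam : ℝ) (x : Torus d L) :
    ∑ γ : Config d L, prob α lam γ * ((γ x).1.length : ℝ) = expectedLength d L α lam := by
  rw [expectedLength, ← Equiv.sum_comp (shiftConfig x)]
  refine Finset.sum_congr rfl fun γ _ => ?_
  have h := shiftConfig_apply x 0 γ
  rw [zero_add] at h
  rw [prob, energy_shift, h, Polygon.length_translate, prob]

lemma sum_prob_cumulativeLength (α lam : ℝ) :
    ∑ γ : Config d L, prob α lam γ * cumulativeLength γ =
      Fintype.card (Torus d L) * expectedLength d L α lam := by
  simp only [cumulativeLength, Finset.mul_sum]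
  rw [Finset.sum_comm]
  simp only [sum_prob_length, Finset.sum_const, Finset.card_univ, nsmul_eq_mul]

/-- The weight of a single polygon at inverse temperature `b`. -/
def polygonWeight (b : ℝ) (γ : Polygon (latticeGraph d (ZMod L))) : ℝ :=
  Real.exp (-b * γ.length) * if 0 < γ.length then (γ.length : ℝ)⁻¹ else 1

omit [NeZero L] in
lemma polygonWeight_pos (b : ℝ) (γ : Polygon (latticeGraph d (ZMod L))) :
    0 < polygonWeight b γ := by
  rw [polygonWeight]
  split_ifs with h
  · have : (0 : ℝ) < γ.length := by exact_mod_cast h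
    positivity
  · positivity

instance : Fintype (Polygon (latticeGraph d (ZMod L))) := Fintype.ofFinite _

open Classical in
variable (d L) in
/-- The total weight of the polygons at the origin. -/
def polygonSum (b : ℝ) : ℝ :=
  ∑ γ : Polygon (latticeGraph d (ZMod L)) with γ.verts = ∅ ∨ 0 ∈ γ.verts, polygonWeight b γ

lemma sum_polygonAt (b : ℝ) (x : Torus d L) [Fintype (PolygonAt d L x)] :
    ∑ γ : PolygonAt d L x, polygonWeight b γ.1 = polygonSum d L b := by
  classical
  rw [polygonSum, ← Finset.sum_subtype (Finset.univ.filter fun γ : Polygon (latticeGraph d (ZMod L))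
    => γ.verts = ∅ ∨ x ∈ γ.verts) (by simp) (polygonWeight b)]
  symm
  refine Finset.sum_equiv (translateEquiv x) (fun γ => ?_) fun γ _ => ?_
  · have h := γ.add_mem_translate x 0
    rw [zero_add] at h
    change _ ↔ γ.translate x ∈ _
    simp only [Finset.mem_filter, Finset.mem_univ, true_and, h, Polygon.translate_verts_eq_empty]
  · change _ = polygonWeight b (γ.translate x)
    rw [polygonWeight, polygonWeight, Polygon.length_translate]

lemma sum_config_prod (b : ℝ) :
    ∑ γ : Config d L, ∏ x, polygonWeight b (γ x).1 =
      polygonSum d L b ^ Fintype.card (Torus d L) := by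
  classical
  let inst : ∀ x : Torus d L, Fintype (PolygonAt d L x) := fun x => Fintype.ofFinite _
  have h := Finset.prod_univ_sum (fun x : Torus d L => (Finset.univ : Finset (PolygonAt d L x)))
    fun x γ => polygonWeight b γ.1
  simp only [sum_polygonAt, Finset.prod_const, Finset.card_univ] at h
  rw [h]
  exact Finset.sum_congr (by ext; simp) fun _ _ => rfl

/-- The logarithmic term of the energy is exactly the factor `1 / length` in the one-polygon weight.
-/
lemma prod_polygonWeight (b : ℝ) (γ : Config d L) :
    ∏ x, polygonWeight b (γ x).1 = Real.exp (-b * cumulativeLength γ -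
      ∑ x : Torus d L with 0 < (γ x).1.length, Real.log ((γ x).1.length : ℝ)) := by
  rw [cumulativeLength, Finset.mul_sum, Finset.sum_filter, ← Finset.sum_sub_distrib, Real.exp_sum]
  refine Finset.prod_congr rfl fun x _ => ?_
  rw [polygonWeight]
  split_ifs with h
  · have : (0 : ℝ) < (γ x).1.length := by exact_mod_cast h
    rw [Real.exp_sub, Real.exp_log this, div_eq_mul_inv]
  · rw [sub_zero, mul_one]

/-- A polygon has as many vertices as edges, so the visit counts sum to the cumulative length; the
truncation `(m - 1) ∨ 0` loses at most one per site. -/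
lemma overlap_bounds (γ : Config d L) :
    cumulativeLength γ - Fintype.card (Torus d L) ≤ overlap γ ∧ overlap γ ≤ cumulativeLength γ := by
  classical
  have hC : cumulativeLength γ =
      ∑ x : Torus d L, ∑ y : Torus d L, if x ∈ (γ y).1.verts then (1 : ℝ) else 0 := by
    rw [cumulativeLength, Finset.sum_comm]
    refine Finset.sum_congr rfl fun y _ => ?_
    rw [Polygon.length_eq_card, Finset.sum_boole]
    simp
  constructor
  · have : (Fintype.card (Torus d L) : ℝ) = ∑ _x : Torus d L, (1 : ℝ) := by simp
    rw [hC, this, ← Finset.sum_sub_distrib, overlap]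
    refine Finset.sum_le_sum fun x _ => ?_
    convert! le_max_left _ _
  · rw [hC, overlap]
    refine Finset.sum_le_sum fun x _ => ?_
    have h0 : (0 : ℝ) ≤ ∑ y : Torus d L, if x ∈ (γ y).1.verts then (1 : ℝ) else 0 :=
      Finset.sum_nonneg fun y _ => by split_ifs <;> norm_num
    have key : ∀ a : ℝ, 0 ≤ a → max (a - 1) 0 ≤ a := fun a ha => max_le (by linarith) ha
    convert! key _ h0

/-- Up to an exponential factor in the volume, the polygons are independent. -/
lemma exp_neg_energy_bounds (α lam : ℝ) (γ : Config d L) :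
    Real.exp (-(|lam| * Fintype.card (Torus d L))) * ∏ x, polygonWeight (α + lam) (γ x).1 ≤
        Real.exp (-energy α lam γ) ∧
      Real.exp (-energy α lam γ) ≤
        Real.exp (|lam| * Fintype.card (Torus d L)) * ∏ x, polygonWeight (α + lam) (γ x).1 := by
  rw [prod_polygonWeight, ← Real.exp_add, ← Real.exp_add, Real.exp_le_exp, Real.exp_le_exp, energy]
  obtain ⟨h1, h2⟩ := overlap_bounds γ
  have h3 : |lam * (overlap γ - cumulativeLength γ)| ≤ |lam| * Fintype.card (Torus d L) := by
    rw [abs_mul]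
    gcongr
    rw [abs_le]
    constructor
    · linarith
    · have : (0 : ℝ) ≤ Fintype.card (Torus d L) := Nat.cast_nonneg _
      linarith
  rw [abs_le] at h3
  constructor <;> nlinarith [h3.1, h3.2]

lemma empty_le_polygonSum (b : ℝ) : 1 ≤ polygonSum d L b := by
  classical
  let γ₀ : Polygon (latticeGraph d (ZMod L)) :=
    ⟨∅, ∅, by simp, by simp, by simp, by simp, by simp, by simp⟩
  have h : polygonWeight b γ₀ = 1 := by simp [polygonWeight, Polygon.length, γ₀]
  rw [← h, polygonSum]
  refine Finset.single_le_sum (f := polygonWeight b) (fun γ _ => (polygonWeight_pos b γ).le) ?_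
  simp [γ₀]

/-- The expected length is controlled by the one-polygon partition function. -/
theorem mul_expectedLength_le (α lam t : ℝ) :
    t * expectedLength d L α lam ≤ 2 * |lam| + Real.log (polygonSum d L (α + lam - t)) -
      Real.log (polygonSum d L (α + lam)) := by
  set N : ℝ := ((Fintype.card (Torus d L) : ℕ) : ℝ) with hN
  have hNpos : 0 < N := by rw [hN]; exact_mod_cast Fintype.card_pos
  set A := polygonSum d L (α + lam) with hA
  set B := polygonSum d L (α + lam - t) with hB
  have hApos : 0 < A := lt_of_lt_of_le one_pos (empty_le_polygonSum _)
  have hBpos : 0 < B := lt_of_lt_of_le one_pos (empty_le_polygonSum _)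
  have hZlow : Real.exp (-(|lam| * N)) * A ^ Fintype.card (Torus d L) ≤
      partitionFunction d L α lam := by
    rw [hA, ← sum_config_prod, Finset.mul_sum, partitionFunction]
    exact Finset.sum_le_sum fun γ _ => (exp_neg_energy_bounds α lam γ).1
  have hZpos : 0 < partitionFunction d L α lam := lt_of_lt_of_le (by positivity) hZlow
  have hprob : ∑ γ : Config d L, prob α lam γ = 1 := by
    simp only [prob]
    rw [← Finset.sum_div, ← partitionFunction, div_self hZpos.ne']
  -- Jensen for `exp`: the exponential moment of the cumulative length bounds its mean, for either
  -- sign of `t`.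
  have hjensen := convexOn_exp.map_sum_le (t := (Finset.univ : Finset (Config d L)))
    (w := prob α lam) (p := fun γ => t * cumulativeLength γ)
    (fun γ _ => div_nonneg (Real.exp_pos _).le hZpos.le) hprob (fun _ _ => Set.mem_univ _)
  have hmean : ∑ γ : Config d L, prob α lam γ • (t * cumulativeLength γ) =
      N * (t * expectedLength d L α lam) := by
    rw [mul_left_comm, hN, ← sum_prob_cumulativeLength, Finset.mul_sum]
    refine Finset.sum_congr rfl fun γ _ => ?_
    rw [smul_eq_mul]
    ring
  have hupper : ∑ γ : Config d L, prob α lam γ • Real.exp (t * cumulativeLength γ) ≤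
      Real.exp (2 * (|lam| * N)) * (B / A) ^ Fintype.card (Torus d L) := by
    have h1 : ∑ γ : Config d L, prob α lam γ • Real.exp (t * cumulativeLength γ) =
        (∑ γ : Config d L, Real.exp (-energy α lam γ) * Real.exp (t * cumulativeLength γ)) /
          partitionFunction d L α lam := by
      rw [Finset.sum_div]
      refine Finset.sum_congr rfl fun γ _ => ?_
      rw [smul_eq_mul, prob]
      ring
    have h2 : ∑ γ : Config d L, Real.exp (-energy α lam γ) * Real.exp (t * cumulativeLength γ) ≤
        Real.exp (|lam| * N) * B ^ Fintype.card (Torus d L) := by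
      rw [hB, ← sum_config_prod, Finset.mul_sum]
      refine Finset.sum_le_sum fun γ _ => ?_
      -- Tilting by `exp (t * cumulativeLength)` only shifts the parameter by `t`.
      have h3 : ∏ x, polygonWeight (α + lam - t) (γ x).1 =
          (∏ x, polygonWeight (α + lam) (γ x).1) * Real.exp (t * cumulativeLength γ) := by
        rw [prod_polygonWeight, prod_polygonWeight, ← Real.exp_add]
        congr 1
        ring
      rw [h3, ← mul_assoc]
      gcongr
      exact (exp_neg_energy_bounds α lam γ).2
    rw [h1, div_le_iff₀ hZpos]
    refine h2.trans ?_
    calc Real.exp (|lam| * N) * B ^ Fintype.card (Torus d L)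
        = Real.exp (2 * (|lam| * N)) * (B / A) ^ Fintype.card (Torus d L) *
            (Real.exp (-(|lam| * N)) * A ^ Fintype.card (Torus d L)) := by
          have h4 : Real.exp (|lam| * N) = Real.exp (2 * (|lam| * N)) * Real.exp (-(|lam| * N)) := by
            rw [← Real.exp_add]; congr 1; ring
          rw [h4, div_pow]
          field_simp
      _ ≤ _ := by gcongr
  rw [hmean] at hjensen
  have h5 := hjensen.trans hupper
  rw [← Real.le_log_iff_exp_le (by positivity), Real.log_mul (by positivity) (by positivity),
    Real.log_exp, Real.log_pow, Real.log_div hBpos.ne' hApos.ne', ← hN] at h5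
  have h6 : N * (t * expectedLength d L α lam) ≤
      N * (2 * |lam| + Real.log B - Real.log A) := by linarith
  exact le_of_mul_le_mul_left h6 hNpos

end Model

end ISAP

namespace ISAP

/-! ### The one-polygon partition function on either side of `log μ`. -/

section SinglePolygonSum

variable {d L : ℕ} [NeZero L]

lemma Polygon.card_verts_ne_one {V : Type} {G : SimpleGraph V} (γ : Polygon G) :
    γ.verts.card ≠ 1 := by
  intro h
  obtain ⟨x, hx⟩ := Finset.card_eq_one.mp h
  obtain ⟨y, hy, _⟩ := γ.existsUnique_out x (by simp [hx])
  have h1 := γ.snd_mem _ hy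
  rw [hx, Finset.mem_singleton] at h1
  have h2 := γ.adj_of_mem _ hy
  rw [h1] at h2
  exact G.loopless.irrefl _ h2

/-- A uniform bound for the one-polygon partition function under an exponential bound for the
number of polygons. -/
lemma polygonSum_le {μ b C : ℝ} {k : ℕ} (hμ : 0 < μ) (hC : 0 ≤ C)
    (hbd : ∀ n, 2 ≤ n → ((polygonsAtZero d (ZMod L) n).ncard : ℝ) ≤ C * (n : ℝ) ^ k * μ ^ n)
    (hb : Real.log μ < b) :
    polygonSum d L b ≤ 1 + C * ∑' n : ℕ, (n : ℝ) ^ k * (μ * Real.exp (-b)) ^ n := by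
  classical
  set r := μ * Real.exp (-b) with hr
  have hr0 : 0 < r := by positivity
  have hr1 : r < 1 := by
    rw [hr, Real.exp_neg, ← div_eq_mul_inv, div_lt_one (Real.exp_pos _)]
    rwa [← Real.log_lt_iff_lt_exp hμ]
  have hsum : Summable fun n : ℕ => (n : ℝ) ^ k * r ^ n :=
    summable_pow_mul_geometric_of_norm_lt_one k (by rwa [Real.norm_of_nonneg hr0.le])
  set S : Finset (Polygon (latticeGraph d (ZMod L))) :=
    Finset.univ.filter fun γ => γ.verts = ∅ ∨ 0 ∈ γ.verts with hS
  have hmaps : ∀ γ ∈ S, γ.length ∈ Finset.range (Fintype.card (Torus d L) + 1) := by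
    intro γ _
    rw [Finset.mem_range, Nat.lt_succ_iff, Polygon.length_eq_card]
    exact Finset.card_le_univ _
  -- Length zero contributes only the empty polygon, length one nothing; otherwise the factor `1 /
  -- n` is dropped and the counting bound applies.
  have hfib : ∀ n, ∑ γ ∈ S with γ.length = n, polygonWeight b γ ≤
      (if n = 0 then 1 else 0) + C * ((n : ℝ) ^ k * r ^ n) := by
    intro n
    have hnn : 0 ≤ C * ((n : ℝ) ^ k * r ^ n) := by positivity
    have hw : ∀ γ ∈ S.filter (fun γ => γ.length = n), polygonWeight b γ ≤ Real.exp (-b) ^ n := by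
      intro γ hγ
      rw [polygonWeight, (Finset.mem_filter.mp hγ).2, ← Real.exp_nat_mul, mul_comm (n : ℝ)]
      refine mul_le_of_le_one_right (Real.exp_pos _).le ?_
      split_ifs with h
      · exact inv_le_one_of_one_le₀ (by exact_mod_cast h)
      · exact le_rfl
    have hsumle := Finset.sum_le_card_nsmul _ _ _ hw
    refine hsumle.trans ?_
    rw [nsmul_eq_mul]
    rcases Nat.lt_or_ge n 2 with hn | hn
    · rcases Nat.lt_or_ge n 1 with hn1 | hn1
      · obtain rfl : n = 0 := by omega
        have hcard : (S.filter fun γ => γ.length = 0).card ≤ 1 := by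
          refine Finset.card_le_one.mpr fun γ hγ γ' hγ' => ?_
          have h1 := (Finset.mem_filter.mp hγ).2
          have h2 := (Finset.mem_filter.mp hγ').2
          rw [Polygon.length, Finset.card_eq_zero] at h1 h2
          exact Polygon.ext_edges (h1.trans h2.symm)
        have : ((S.filter fun γ => γ.length = 0).card : ℝ) ≤ 1 := by exact_mod_cast hcard
        simp only [pow_zero, mul_one, if_true] at hnn ⊢
        linarith
      · obtain rfl : n = 1 := by omega
        have hcard : S.filter (fun γ => γ.length = 1) = ∅ :=
          Finset.filter_eq_empty_iff.mpr fun γ _ => by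
            rw [Polygon.length_eq_card]; exact γ.card_verts_ne_one
        rw [hcard]
        simpa using hnn
    · have hsub : ((S.filter fun γ => γ.length = n : Finset _) : Set _) ⊆
          polygonsAtZero d (ZMod L) n := by
        intro γ hγ
        obtain ⟨h1, h2⟩ := Finset.mem_filter.mp (Finset.mem_coe.mp hγ)
        rw [Polygon.length_eq_card] at h2
        rcases (Finset.mem_filter.mp h1).2 with h3 | h3
        · rw [h3, Finset.card_empty] at h2
          omega
        · exact ⟨h3, h2⟩
      have hcard := Set.ncard_le_ncard hsub (finite_polygonsAtZero _ _)
      rw [Set.ncard_coe_finset] at hcard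
      have hcard' : ((S.filter fun γ => γ.length = n).card : ℝ) ≤ C * (n : ℝ) ^ k * μ ^ n :=
        le_trans (by exact_mod_cast hcard) (hbd n hn)
      rw [if_neg (by omega), zero_add]
      calc _ ≤ C * (n : ℝ) ^ k * μ ^ n * Real.exp (-b) ^ n := by gcongr
        _ = _ := by rw [hr, mul_pow]; ring
  have hps : polygonSum d L b = ∑ γ ∈ S, polygonWeight b γ := by
    rw [polygonSum, hS]
  rw [hps, ← Finset.sum_fiberwise_of_maps_to hmaps]
  refine (Finset.sum_le_sum fun n _ => hfib n).trans ?_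
  rw [Finset.sum_add_distrib, ← Finset.mul_sum]
  gcongr
  · rw [Finset.sum_ite_eq' (Finset.range _) 0]
    split_ifs <;> norm_num
  · exact hsum.sum_le_tsum _ fun n _ => by positivity

lemma le_polygonSum (b : ℝ) {n : ℕ} (hn : n ≠ 0) :
    ((polygonsAtZero d (ZMod L) n).ncard : ℝ) * (Real.exp (-b * n) / n) ≤ polygonSum d L b := by
  classical
  rw [polygonSum, Set.ncard_eq_toFinset_card _ (finite_polygonsAtZero _ _), ← nsmul_eq_mul,
    ← Finset.sum_const]
  refine (Finset.sum_le_sum (g := polygonWeight b) fun γ hγ => ?_).trans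
    (Finset.sum_le_sum_of_subset_of_nonneg (fun γ hγ => ?_) fun γ _ _ => (polygonWeight_pos b γ).le)
  · have h := ((Set.Finite.mem_toFinset _).mp hγ).2
    rw [← Polygon.length_eq_card] at h
    rw [polygonWeight, h, if_pos (Nat.pos_of_ne_zero hn), div_eq_mul_inv]
  · have h := ((Set.Finite.mem_toFinset _).mp hγ).1
    simp [h]

end SinglePolygonSum

/-- The growth rate of polygons on the lattice, which also bounds the number of polygons on all
tori. -/
theorem exists_polygon_growth_rate {d : ℕ} (hd : 2 ≤ d) :
    ∃ μ : ℝ, 0 < μ ∧ IsConnectiveConstant d μ ∧ ∃ C : ℝ, 0 ≤ C ∧ ∃ k : ℕ, ∀ L n : ℕ, 2 ≤ n →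
      ((polygonsAtZero d (ZMod L) n).ncard : ℝ) ≤ C * (n : ℝ) ^ k * μ ^ n := by
  obtain ⟨μ, hμ, hlim, h1, h2⟩ := exists_loop_growth_rate hd
  refine ⟨μ, hμ, ?_, 2 * 4 ^ (d + 10) * μ ^ 2, by positivity, d + 10, fun L n hn => ?_⟩
  · refine hlim.congr' ?_
    filter_upwards [eventually_ge_atTop 1] with k hk
    rw [ncard_originPolygons (by omega)]
  · have h3 : ((polygonsAtZero d (ZMod L) n).ncard : ℝ) ≤
        (loopWords (AddMonoidHom.id (Fin d → ℤ)) n).ncard + (periodicWords d n).ncard := by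
      exact_mod_cast ncard_polygonsAtZero_le_add (ZMod L) n
    have h4 : (2 * n + 2 : ℝ) ^ (d + 10) ≤ (4 * n) ^ (d + 10) := by
      have : (2 : ℝ) ≤ n := by exact_mod_cast hn
      gcongr
      linarith
    calc ((polygonsAtZero d (ZMod L) n).ncard : ℝ)
        ≤ 2 * ((2 * n + 2) ^ (d + 10) * μ ^ (n + 2)) := by linarith [h1 n hn, h2 n hn]
      _ ≤ 2 * ((4 * n) ^ (d + 10) * μ ^ (n + 2)) := by gcongr
      _ = _ := by rw [mul_pow]; ring

/-- Below the critical point the one-polygon partition function diverges. -/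
lemma tendsto_polygonSum {d : ℕ} {μ b : ℝ} (hμ : 0 < μ) (hconn : IsConnectiveConstant d μ)
    (hb : b < Real.log μ) : Tendsto (fun n : ℕ => polygonSum d (n + 1) b) atTop atTop := by
  rw [tendsto_atTop]
  intro M
  -- Half the gap: a single even length `2 * k` with at least `exp ((b + δ) * (2 * k))` polygons
  -- already contributes more than `M`.
  set δ := (Real.log μ - b) / 2 with hδ
  have hδ0 : 0 < δ := by rw [hδ]; linarith
  have hlt : Real.exp (b + δ) < μ := by
    rw [← Real.lt_log_iff_exp_lt hμ, hδ]; linarith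
  have hlarge : ∀ᶠ k : ℕ in atTop, M ≤ δ ^ 2 * k :=
    (tendsto_natCast_atTop_atTop.const_mul_atTop (by positivity)).eventually_ge_atTop M
  obtain ⟨k, hk1, hk2, hk3⟩ := ((hconn.eventually_const_lt hlt).and
    (hlarge.and (eventually_ge_atTop 1))).exists
  have hk0 : (0 : ℝ) < k := by exact_mod_cast hk3
  set G : ℝ := ((originPolygons d (2 * k)).ncard : ℝ) with hG
  have hGle : Real.exp ((b + δ) * (2 * k)) ≤ G := by
    have h1 := Real.rpow_le_rpow (Real.exp_pos _).le hk1.le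
      (show (0 : ℝ) ≤ ((2 * k : ℕ) : ℝ) by positivity)
    rw [← Real.rpow_mul (Nat.cast_nonneg _), one_div, inv_mul_cancel₀ (by push_cast; positivity),
      Real.rpow_one, ← Real.exp_mul] at h1
    exact_mod_cast h1
  -- The side `n + 1` must be at least three for distinct steps and at least `2 * k` for loops of
  -- that length to survive.
  filter_upwards [eventually_ge_atTop (2 * k + 3)] with n hn
  refine le_trans ?_ (le_polygonSum (d := d) (L := n + 1) b (n := 2 * k) (by omega))
  have h2 : G ≤ ((polygonsAtZero d (ZMod (n + 1)) (2 * k)).ncard : ℝ) := by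
    rw [hG, ncard_originPolygons (by omega)]
    exact_mod_cast le_ncard_polygonsAtZero_torus (by omega) (by omega) (by omega)
  have h3 := Real.quadratic_le_exp_of_nonneg (show 0 ≤ δ * (2 * k) by positivity)
  calc M ≤ δ ^ 2 * k := hk2
    _ ≤ Real.exp (δ * (2 * k)) / (2 * k) := by
        rw [le_div_iff₀ (by positivity)]
        nlinarith
    _ = Real.exp ((b + δ) * (2 * k)) * (Real.exp (-b * (2 * k)) / (2 * k)) := by
        rw [← mul_div_assoc, ← Real.exp_add]
        congr 2
        ring
    _ ≤ _ := by
        push_cast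
        gcongr
        exact hGle.trans h2

end ISAP

/-! ### The phase transition. -/

theorem theorem1 (d : ℕ) (hd : 2 ≤ d) :
    ∃ μ : ℝ, 0 < μ ∧ ISAP.IsConnectiveConstant d μ ∧
      ∀ α lam : ℝ,
        (Real.log μ < α + lam → ISAP.limsupExpectedLength d α lam < ⊤) ∧
        (α + lam < Real.log μ → ISAP.limsupExpectedLength d α lam = ⊤) := by
  open ISAP in
  obtain ⟨μ, hμ, hconn, C, hC, k, hbd⟩ := exists_polygon_growth_rate hd
  refine ⟨μ, hμ, hconn, fun α lam => ⟨fun h => ?_, fun h => ?_⟩⟩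
  · obtain ⟨t, ht0, ht⟩ : ∃ t : ℝ, 0 < t ∧ Real.log μ < α + lam - t :=
      ⟨(α + lam - Real.log μ) / 2, by linarith, by linarith⟩
    obtain ⟨K, hK⟩ : ∃ K : ℝ, ∀ n : ℕ, polygonSum d (n + 1) (α + lam - t) ≤ K :=
      ⟨_, fun n => polygonSum_le hμ hC (hbd (n + 1)) ht⟩
    have hbound : ∀ n : ℕ, expectedLength d (n + 1) α lam ≤ (2 * |lam| + Real.log K) / t := by
      intro n
      have h1 := mul_expectedLength_le (d := d) (L := n + 1) α lam t
      have h2 := Real.log_nonneg (empty_le_polygonSum (d := d) (L := n + 1) (α + lam))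
      have h3 := Real.log_le_log (lt_of_lt_of_le one_pos (empty_le_polygonSum _)) (hK n)
      rw [le_div_iff₀ ht0]
      linarith
    refine lt_of_le_of_lt ?_ (EReal.coe_lt_top ((2 * |lam| + Real.log K) / t))
    exact limsup_le_of_le (by isBoundedDefault)
      (Eventually.of_forall fun n => EReal.coe_le_coe_iff.mpr (hbound n))
  -- A negative tilt past the critical point keeps the tilted sum bounded, so the expected length is
  -- at least of order `log polygonSum`, which diverges.
  · obtain ⟨t, ht0, ht⟩ : ∃ t : ℝ, 0 < t ∧ Real.log μ < α + lam - -t :=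
      ⟨Real.log μ - (α + lam) + 1, by linarith, by linarith⟩
    obtain ⟨K, hK⟩ : ∃ K : ℝ, ∀ n : ℕ, polygonSum d (n + 1) (α + lam - -t) ≤ K :=
      ⟨_, fun n => polygonSum_le hμ hC (hbd (n + 1)) ht⟩
    have hbound : ∀ n : ℕ, (Real.log (polygonSum d (n + 1) (α + lam)) +
        (-(2 * |lam|) - Real.log K)) / t ≤ expectedLength d (n + 1) α lam := by
      intro n
      have h1 := mul_expectedLength_le (d := d) (L := n + 1) α lam (-t)
      have h3 := Real.log_le_log (lt_of_lt_of_le one_pos (empty_le_polygonSum _)) (hK n)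
      rw [div_le_iff₀ ht0]
      linarith
    have htend : Tendsto (fun n : ℕ => expectedLength d (n + 1) α lam) atTop atTop :=
      tendsto_atTop_mono hbound ((tendsto_atTop_add_const_right _ _
        (Real.tendsto_log_atTop.comp (tendsto_polygonSum hμ hconn h))).atTop_div_const ht0)
    exact (EReal.tendsto_coe_atTop.comp htend).limsup_eq
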